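/- Work over $\mathbb C$. For a bialgebra $\mathcal A$, a representation is a matrix $v=(v_{ij})$ over $\mathcal A$ with $\Delta v_{ij}=\sum_k v_{ik}\otimes v_{kj}$ and $\epsilon(v_{ij})=\delta_{ij}$. Write $\mathrm{Mor}(v,w)$ for the complex matrices $M$ with $Mv=wM$, and put $(v\otimes w)_{ij,kl}=v_{ik}w_{jl}$ and $a*\rho=(\rho\otimes\mathrm{id})\Delta a$ for $a\in\mathcal A$, $\rho\in\mathcal A'$ (linear dual). Let $\mathcal A$ be a Hopf algebra with invertible antipode such that every representation is completely reducible, and let $\Lambda=(\Lambda_{rs})_{r,s\in\mathcal I}$, $\mathcal I$ finite, be an irreducible representation such that $\mathrm{Mor}(v\otimes w,\Lambda\otimes v\otimes w)=\{0\}$ for all irreducible representations $v,w$. Let $\mathcal B$ be a bialgebra containing $\mathcal A$ as a sub-bialgebra, and let $p_s\in\mathcal B$ $(s\in\mathcal I)$ be such that 1. $\mathcal B$ is generated as an algebra by $\mathcal A$ and the $p_s$; 2. $\begin{pmatrix}\Lambda&p\\0&1\end{pmatrix}$ is a representation; 3. $p_i\notin\mathcal A$ for some $i$; 4. $\Gamma\mathcal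 A\subset\Gamma$, where $\Gamma=\mathcal A\cdot\mathrm{span}\{p_i: i\in\mathcal I\}+\mathcal A$. Then there are unique functionals $f_{st}\in\mathcal A'$ with $p_sa-\sum_t(a*f_{st})p_t\in\mathcal A$ for all $s\in\mathcal I$ and $a\in\mathcal A$. Put $R_{ij,sm}=f_{im}(\Lambda_{js})$, and assume that $R^2=1$ and that for every row vector $x=(x_{ij})\in\mathbb C^{\mathcal I\times\mathcal I}$ $$x(R+1)=0\iff\text{there are } b_i,c\in\mathcal A \text{ with } \sum_{i,j} x_{ij}p_ip_j+\sum_i b_ip_i+c=0 .$$ For $n\ge 0$ let $R_k$ $(1\le k<n)$ be $R$ acting in the places $k,k+1$ of $(\mathbb C^{\mathcal I})^{\otimes n}$. For a permutation $\pi$ of $\{1,\dots,n\}$ let $R_\pi=R_{i_1}\cdots R_{i_s}$, where $\pi=t_{i_1}\cdots t_{i_s}$ is a (chosen) decomposition of minimal length into the transpositions $t_k=(k\;k{+}1)$. Let $S_n=\frac1{n!}\sum_\pi R_\pi$ and $\dim S_n=\dim\operatorname{im}S_n$. Then a basis of $\operatorname{im}S_n$ and a basis of $\operatorname{im}(1-S_n)$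 together form a basis of $(\mathbb C^{\mathcal I})^{\otimes n}$. For each $n$ choose such a basis, and let $\alpha^{in}$ $(1\le i\le\dim S_n)$ be the elements of the dual basis that correspond to the basis vectors of $\operatorname{im}S_n$. Put $\alpha^{in}p^{\otimes n}=\sum_{j_1,\dots,j_n}\alpha^{in}_{j_1\dots j_n}p_{j_1}\cdots p_{j_n}$. Then the elements $\alpha^{in}p^{\otimes n}$ $(n\ge0,\ 1\le i\le\dim S_n)$ form a basis of the left $\mathcal A$-module $\mathcal B$. For every $N\ge 0$ those with $n\le N$ form a basis of the left $\mathcal A$-module $$\mathcal B^N=\mathcal A\cdot\mathrm{span}\{p_{i_1}\cdots p_{i_n}: i_1,\dots,i_n\in\mathcal I,\ 0\le n\le N\}.$$ In particular $\dim_{\mathcal A}\mathcal B^N=\sum_{n=0}^N\dim S_n$, where $\dim_{\mathcal A}$ of a free module is the number of elements of any finite basis. -/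

import Mathlib

open scoped TensorProduct Kronecker Nat

noncomputable section

namespace InhomogeneousQG

/-! ### Matrix representations of a bialgebra -/

section Representations

variable {A : Type*} [Ring A] [Bialgebra ℂ A]

/-- A square matrix `v` over a bialgebra is a representation (a matrix corepresentation):
`Δ v_ij = ∑ k, v_ik ⊗ v_kj` and `ε v_ij = δ_ij`. -/
def IsRepresentation {n : Type*} [Fintype n] [DecidableEq n] (v : Matrix n n A) : Prop :=
  (∀ i j, Coalgebra.comul (R := ℂ) (v i j) = ∑ k, v i k ⊗ₜ[ℂ] v k j) ∧
    ∀ i j, Coalgebra.counit (R := ℂ) (v i j) = (1 : Matrix n n ℂ) i j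

/-- The subspace `W` of `ℂⁿ` is invariant under `v`, i.e. `v W ⊆ W ⊗ A`. As the linear functionals
on `A` separate `W ⊗ A` from the rest of `ℂⁿ ⊗ A`, this is tested by applying functionals. -/
def IsInvariant {n : Type*} [Fintype n] (v : Matrix n n A) (W : Submodule ℂ (n → ℂ)) : Prop :=
  ∀ g : A →ₗ[ℂ] ℂ, ∀ x ∈ W, (v.map g).mulVec x ∈ W

/-- Irreducible representations: of positive dimension, without proper invariant subspaces. -/
def IsIrreducibleRep {n : Type*} [Fintype n] [DecidableEq n] (v : Matrix n n A) : Prop :=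
  IsRepresentation v ∧ Nonempty n ∧ ∀ W : Submodule ℂ (n → ℂ), IsInvariant v W → W = ⊥ ∨ W = ⊤

/-- Complete reducibility: every invariant subspace has an invariant complement. -/
def IsCompletelyReducible {n : Type*} [Fintype n] (v : Matrix n n A) : Prop :=
  ∀ W : Submodule ℂ (n → ℂ), IsInvariant v W → ∃ W', IsInvariant v W' ∧ IsCompl W W'

/-- `M ∈ Mor(v, w)`, i.e. `M v = w M`. -/
def IsIntertwiner {m n : Type*} [Fintype m] [Fintype n] (v : Matrix m m A) (w : Matrix n n A)
    (M : Matrix n m ℂ) : Prop :=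
  M.map (algebraMap ℂ A) * v = w * M.map (algebraMap ℂ A)

/-- `a * ρ = (ρ ⊗ id) Δ a` for a linear functional `ρ` on `A`. -/
def conv (a : A) (ρ : A →ₗ[ℂ] ℂ) : A :=
  TensorProduct.lid ℂ A (ρ.rTensor A (Coalgebra.comul (R := ℂ) a))

end Representations

/-! ### Inhomogeneous quantum groups -/

section Inhomogeneous

variable {A B I : Type*} [Ring A] [Bialgebra ℂ A] [Ring B] [Bialgebra ℂ B]
  [Fintype I] [DecidableEq I]

/-- `Γ = A · span {p_i} + A`, as a left `A`-submodule of `B`. -/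
def Gam (A : Type*) {B I : Type*} [Ring A] [Ring B] [Module A B] (p : I → B) : Submodule A B :=
  Submodule.span A (Set.range p) ⊔ Submodule.span A {1}

/-- The bialgebra `B` is an inhomogeneous extension of `A`, embedded by `ι`, with the translations
`p_s` transforming according to `Λ`. The left `A`-module structure of `B` is the one given by
left multiplication. -/
structure IsInhomogeneousExtension [Module A B] (Λ : Matrix I I A) (ι : A →ₐc[ℂ] B)
    (p : I → B) : Prop where
  /-- the `A`-module structure is left multiplication -/
  smul_eq : ∀ (a : A) (b : B), a • b = ι a * b
  /-- `B` is generated as an algebra by `A` and the `p_s` -/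
  generated : Algebra.adjoin ℂ (Set.range ι ∪ Set.range p) = ⊤
  /-- `A` is a sub-bialgebra -/
  injective : Function.Injective ι
  /-- the block matrix with rows `(Λ, p)` and `(0, 1)` is a representation -/
  block : IsRepresentation
    (Matrix.fromBlocks (Λ.map ι) (Matrix.of fun s (_ : Unit) => p s) 0 1 :
      Matrix (I ⊕ Unit) (I ⊕ Unit) B)
  /-- some `p_i` is not in `A` -/
  notMem : ∃ i, p i ∉ Set.range ι
  /-- `Γ A ⊆ Γ` -/
  mul_mem : ∀ x ∈ Gam A p, ∀ a : A, x * ι a ∈ Gam A p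

/-- The functionals `f_st` on `A` describe the leading terms of the commutation relations:
`p_s a ≡ ∑ t, (a * f_st) p_t` modulo `A`, for all `a` in `A`. -/
def IsCommutationFamily (ι : A →ₐc[ℂ] B) (p : I → B) (f : I → I → A →ₗ[ℂ] ℂ) : Prop :=
  ∀ (s : I) (a : A), p s * ι a - ∑ t, ι (conv a (f s t)) * p t ∈ Set.range ι

/-- The `R`-matrix `R_{ij,sm} = f_im(Λ_js)`. -/
def RMatrix (f : I → I → A →ₗ[ℂ] ℂ) (Λ : Matrix I I A) : Matrix (I × I) (I × I) ℂ :=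
  Matrix.of fun x y => f x.1 y.2 (Λ x.2 y.1)

/-- `x` is the coefficient array of the quadratic part of a relation
`∑ x_ij p_i p_j + ∑ b_i p_i + c = 0` that holds in `B`, with `b_i` and `c` in `A`. -/
def IsQuadraticRelation (ι : A →ₐc[ℂ] B) (p : I → B) (x : I × I → ℂ) : Prop :=
  ∃ (b : I → A) (c : A), ∑ i, ∑ j, x (i, j) • (p i * p j) + ∑ i, ι (b i) * p i + ι c = 0

/-- The value `∑ c_{i₁…iₙ} p_{i₁} ⋯ p_{iₙ}` of the covector `c` on the `n`-th power of the
column `p`. -/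
def evalTensor (p : I → B) {n : ℕ} (c : ((Fin n → I) → ℂ) →ₗ[ℂ] ℂ) : B :=
  ∑ x : Fin n → I, c (Pi.single x 1) • (List.ofFn fun k => p (x k)).prod

/-- `B^N = A · span {p_{i₁} ⋯ p_{iₙ} : n ≤ N}`. -/
def filtration (A : Type*) {B I : Type*} [Ring A] [Ring B] [Module A B] (p : I → B) (N : ℕ) :
    Submodule A B :=
  Submodule.span A {b | ∃ n ≤ N, ∃ x : Fin n → I, b = (List.ofFn fun k => p (x k)).prod}

end Inhomogeneous

/-- The left `A`-module `M` is free and all its finite bases have `d` elements. (The rank of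
Mathlib is a supremum over independent families and can be larger than the size of a basis over
a noncommutative ring.) -/
def HasDim (A M : Type*) [Ring A] [AddCommGroup M] [Module A M] (d : ℕ) : Prop :=
  Nonempty (Module.Basis (Fin d) A M) ∧ ∀ m : ℕ, Nonempty (Module.Basis (Fin m) A M) → m = d

/-! ### The symmetrizer -/

/-- The transposition of the neighbours `k` and `k + 1`. -/
def adjSwap (n : ℕ) (k : Fin (n - 1)) : Equiv.Perm (Fin n) :=
  Equiv.swap ⟨k, by omega⟩ ⟨k + 1, by omega⟩

/-- `π = t_{i₁} ⋯ t_{iₛ}` is a decomposition of minimal length. -/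
def IsReducedWord {n : ℕ} (π : Equiv.Perm (Fin n)) (l : List (Fin (n - 1))) : Prop :=
  (l.map (adjSwap n)).prod = π ∧
    ∀ l' : List (Fin (n - 1)), (l'.map (adjSwap n)).prod = π → l.length ≤ l'.length

theorem exists_isReducedWord {n : ℕ} (π : Equiv.Perm (Fin n)) : ∃ l, IsReducedWord π l := by
  classical
  have hex : ∃ l : List (Fin (n - 1)), (l.map (adjSwap n)).prod = π := by
    rcases n with _ | n
    · exact ⟨[], Subsingleton.elim _ _⟩
    · have h : π ∈ Submonoid.closure (Set.range fun i : Fin n =>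
          Equiv.swap i.castSucc i.succ) := by
        rw [Equiv.Perm.mclosure_swap_castSucc_succ]; trivial
      induction h using Submonoid.closure_induction with
      | mem x hx =>
        obtain ⟨i, rfl⟩ := hx
        exact ⟨[i], by simp [adjSwap]; rfl⟩
      | one => exact ⟨[], rfl⟩
      | mul x y _ _ hx hy =>
        obtain ⟨l, rfl⟩ := hx
        obtain ⟨l', rfl⟩ := hy
        exact ⟨l ++ l', by simp⟩
  have hlen : ∃ d, ∃ l : List (Fin (n - 1)), l.length = d ∧ (l.map (adjSwap n)).prod = π :=
    let ⟨l, hl⟩ := hex; ⟨_, l, rfl, hl⟩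
  obtain ⟨l, h1, h2⟩ := Nat.find_spec hlen
  exact ⟨l, h2, fun l' hl' => h1 ▸ Nat.find_min' hlen ⟨l', rfl, hl'⟩⟩

/-- A chosen minimal decomposition of `π` into transpositions of neighbours. -/
def reducedWord {n : ℕ} (π : Equiv.Perm (Fin n)) : List (Fin (n - 1)) :=
  (exists_isReducedWord π).choose

section Symmetrizer

variable {I : Type*} [Fintype I] [DecidableEq I]

/-- `R_k = 1 ⊗ ⋯ ⊗ 1 ⊗ R ⊗ 1 ⊗ ⋯ ⊗ 1`, with `R` acting in the places `k` and `k + 1` of the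
`n`-th tensor power of `ℂ^I`, whose basis is indexed by the maps from `Fin n` to `I`. -/
def Rk (R : Matrix (I × I) (I × I) ℂ) (n : ℕ) (k : Fin (n - 1)) :
    Matrix (Fin n → I) (Fin n → I) ℂ :=
  Matrix.of fun x y =>
    let a : Fin n := ⟨k, by omega⟩
    let b : Fin n := ⟨k + 1, by omega⟩
    if ∀ j, j ≠ a → j ≠ b → x j = y j then R (x a, x b) (y a, y b) else 0

/-- `R_π = R_{i₁} ⋯ R_{iₛ}` for a minimal decomposition `π = t_{i₁} ⋯ t_{iₛ}`. -/
def Rperm (R : Matrix (I × I) (I × I) ℂ) {n : ℕ} (π : Equiv.Perm (Fin n)) :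
    Matrix (Fin n → I) (Fin n → I) ℂ :=
  ((reducedWord π).map (Rk R n)).prod

/-- The symmetrizer `S_n = (1 / n!) ∑ π, R_π`. -/
def symmetrizer (R : Matrix (I × I) (I × I) ℂ) (n : ℕ) : Matrix (Fin n → I) (Fin n → I) ℂ :=
  ((n ! : ℂ)⁻¹) • ∑ π : Equiv.Perm (Fin n), Rperm R π

/-- A basis of the `n`-th tensor power of `ℂ^I` that consists of a basis of `im S_n`
followed by a basis of `im (1 - S_n)`. -/
def IsAdapted (R : Matrix (I × I) (I × I) ℂ) {n : ℕ}
    (γ : Module.Basis (Fin (symmetrizer R n).rank ⊕ Fin (1 - symmetrizer R n).rank) ℂ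
      ((Fin n → I) → ℂ)) : Prop :=
  Submodule.span ℂ (Set.range fun i => γ (Sum.inl i)) =
      LinearMap.range (symmetrizer R n).mulVecLin ∧
    Submodule.span ℂ (Set.range fun j => γ (Sum.inr j)) =
      LinearMap.range (1 - symmetrizer R n).mulVecLin

end Symmetrizer

end InhomogeneousQG

end

/-! # A basis of an inhomogeneous quantum group

Places are counted from `0`. Write `P x = p_{x₀} ⋯ p_{xₙ₋₁}` for the words in the translations and
`B_{<n}` (`lower A p n`) for the left `A`-submodule that the words of length less than `n` span. The
theorem says that the words of length `n`, modulo `B_{<n}`, satisfy over `A` the relations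
`S_n P = P` and no others.

That `S_n P ≡ P` is the easy half: the quadratic relations give `R_k P ≡ P` for every `k`
(`act_natRk`, `act_symmetrizer`).

For the other half, let `∑ c_x P x` with complex coefficients lie in `B_{<n}`. The part of its
coproduct in degree `(n - 1, 1)` must vanish. In that part the letters picked for the second tensor
factor leave entries of `Λ` behind in the first factor. Moving these to the left end by means of
`p_s a ≡ ∑ (a * f_st) p_t` produces factors `R`, so that
`c (1 + R_0 + R_1 R_0 + ⋯ + R_{n-2} ⋯ R_0)` is, place by place, a relation between words of length
`n - 1` (`comul_wordProd_succ`). By induction `c` is killed by the braided factorial, which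
satisfies `D_n = (1 + R_0 + ⋯ + R_{n-2} ⋯ R_0) (1 ⊗ D_{n-1})` (`vecMul_braidedFactorial`,
`braidedFactorial_succ`). Coefficients in `A` reduce to complex ones by the fundamental theorem of
Hopf modules, because words are right coinvariant modulo shorter words; this is where the inverse of
the antipode enters (`extract`).

It remains to see that `D_n = n! S_n` and that `S_n` is idempotent. The matrix `R` satisfies the
braid relation, since it intertwines `Λ ⊗ Λ` with itself and `f` is multiplicative (`isBraiding`).
With `R² = 1` the `R_k` thus satisfy the Coxeter relations of the symmetric group. That
these relations present the symmetric group is proved by counting: every word can be brought to one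
of `n!` normal forms, which are coset representatives times normal forms for one letter
less (`CoxeterRelations.listProd_eq`, `CoxeterRelations.sum_eq`). Hence `R_π` is multiplicative in
`π`, and the sum of the `R_π` is the sum of the normal forms, which is `D_n`.

The functionals `f_st` exist and are unique because the translations are linearly independent over
`A` modulo `A` (`coeff_eq_zero`): over the complex numbers this holds as `Λ` is irreducible, and the
step to `A` is again the one for Hopf modules.
-/

open scoped TensorProduct Kronecker Nat

noncomputable section

namespace InhomogeneousQG

/-! ### Words in generators satisfying the Coxeter relations -/

section Words

variable {M M' : Type*} [Monoid M] [Monoid M']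

/-- The elements `r 0, …, r (n - 2)` of a monoid satisfy the Coxeter relations of the
symmetric group on `n` letters. -/
structure CoxeterRelations (n : ℕ) (r : ℕ → M) : Prop where
  sq : ∀ i, i + 1 < n → r i * r i = 1
  braid : ∀ i, i + 2 < n → r i * r (i + 1) * r i = r (i + 1) * r i * r (i + 1)
  comm : ∀ i j, i + 1 < j → j + 1 < n → r i * r j = r j * r i

theorem CoxeterRelations.shift {n : ℕ} {r : ℕ → M} (h : CoxeterRelations (n + 1) r) :
    CoxeterRelations n fun i => r (i + 1) where
  sq i hi := h.sq _ (by omega)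
  braid i hi := h.braid _ (by omega)
  comm i j hi hj := h.comm _ _ (by omega) (by omega)

/-- The product `r (k - 1) * ⋯ * r 1 * r 0`. For `r i = t_i`, these are representatives of the left
cosets of the stabilizer of the first letter. -/
def descProd (r : ℕ → M) : ℕ → M
  | 0 => 1
  | k + 1 => r k * descProd r k

theorem descProd_succ' (r : ℕ → M) (k : ℕ) :
    descProd r (k + 1) = descProd (fun i => r (i + 1)) k * r 0 := by
  induction k with
  | zero => simp [descProd]
  | succ k ih => rw [descProd, ih, descProd, mul_assoc]

theorem CoxeterRelations.mul_descProd_of_lt {n : ℕ} {r : ℕ → M} (h : CoxeterRelations n r) {i : ℕ}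
    (hi : i + 1 < n) : ∀ {k : ℕ}, k < i → r i * descProd r k = descProd r k * r i
  | 0, _ => by simp [descProd]
  | k + 1, hk => by
    rw [descProd, ← mul_assoc, ← h.comm k i (by omega) hi, mul_assoc,
      h.mul_descProd_of_lt hi (by omega), mul_assoc]

theorem CoxeterRelations.mul_descProd_of_gt {n : ℕ} {r : ℕ → M} (h : CoxeterRelations n r) {i : ℕ} :
    ∀ {k : ℕ}, i + 1 < k → k < n → r i * descProd r k = descProd r k * r (i + 1)
  | 0, hk, _ => by omega
  | k + 1, hk, hn => by
    rcases (show i + 1 = k ∨ i + 1 < k by omega) with rfl | hik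
    · rw [descProd, descProd, ← mul_assoc, ← mul_assoc, h.braid i (by omega), mul_assoc,
        h.mul_descProd_of_lt (i := i + 1) (by omega) (Nat.lt_succ_self i), mul_assoc, mul_assoc,
        mul_assoc]
    · rw [descProd, ← mul_assoc, h.comm i k hik hn, mul_assoc,
        h.mul_descProd_of_gt hik (by omega), mul_assoc]

/-- The `n!` normal forms of the products of `r 0, …, r (n - 2)`: coset representatives times the
normal forms of the products of `r 1, …, r (n - 2)`. -/
def normalForms : ℕ → (ℕ → M) → List M
  | 0, _ => [1]
  | n + 1, r => (List.range (n + 1)).flatMap fun k =>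
      (normalForms n fun i => r (i + 1)).map (descProd r k * ·)

theorem mem_normalForms_succ {n : ℕ} {r : ℕ → M} {x : M} :
    x ∈ normalForms (n + 1) r ↔
      ∃ k < n + 1, ∃ y ∈ normalForms n fun i => r (i + 1), descProd r k * y = x := by
  simp [normalForms]

theorem length_normalForms (n : ℕ) (r : ℕ → M) : (normalForms n r).length = n ! := by
  induction n generalizing r with
  | zero => rfl
  | succ n ih => simp [normalForms, ih, List.length_flatMap, Nat.factorial_succ]

theorem map_descProd (g : M →* M') (r : ℕ → M) (k : ℕ) :
    g (descProd r k) = descProd (fun i => g (r i)) k := by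
  induction k with
  | zero => simp [descProd]
  | succ k ih => simp [descProd, ih]

theorem map_normalForms (g : M →* M') (n : ℕ) (r : ℕ → M) :
    (normalForms n r).map g = normalForms n fun i => g (r i) := by
  induction n generalizing r with
  | zero => simp [normalForms]
  | succ n ih =>
    simp [normalForms, List.map_flatMap, Function.comp_def, ← ih, map_descProd]

theorem one_mem_normalForms (n : ℕ) (r : ℕ → M) : (1 : M) ∈ normalForms n r := by
  induction n generalizing r with
  | zero => simp [normalForms]
  | succ n ih =>
    exact mem_normalForms_succ.2 ⟨0, by omega, 1, ih _, by simp [descProd]⟩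

/-- The set of normal forms is stable under left multiplication by a generator: `r i` either changes
the coset representative, or passes through it and becomes `r i` or `r (i + 1)`, which act on the
remaining letters. -/
theorem CoxeterRelations.mul_mem_normalForms {n : ℕ} {r : ℕ → M} (h : CoxeterRelations n r) {i : ℕ}
    (hi : i + 1 < n) {x : M} (hx : x ∈ normalForms n r) : r i * x ∈ normalForms n r := by
  induction n generalizing r i x with
  | zero => omega
  | succ n ih =>
    obtain ⟨k, hk, y, hy, rfl⟩ := mem_normalForms_succ.1 hx
    refine mem_normalForms_succ.2 ?_
    rcases lt_trichotomy k i with hki | rfl | hki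
    · obtain ⟨j, rfl⟩ : ∃ j, i = j + 1 := ⟨i - 1, by omega⟩
      exact ⟨k, hk, _, ih h.shift (i := j) (by omega) hy, by
        rw [← mul_assoc, ← mul_assoc, h.mul_descProd_of_lt hi hki]⟩
    · exact ⟨k + 1, hi, y, hy, by rw [descProd, mul_assoc]⟩
    · rcases (show k = i + 1 ∨ i + 1 < k by omega) with rfl | hik
      · exact ⟨i, by omega, y, hy, by
          rw [descProd, ← mul_assoc, ← mul_assoc, h.sq i hi, one_mul]⟩
      · exact ⟨k, hk, _, ih h.shift (i := i) (by omega) hy, by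
          rw [← mul_assoc, ← mul_assoc, h.mul_descProd_of_gt hik hk]⟩

theorem CoxeterRelations.prod {n : ℕ} {r : ℕ → M} {r' : ℕ → M'} (h : CoxeterRelations n r)
    (h' : CoxeterRelations n r') : CoxeterRelations n fun i => (r i, r' i) where
  sq i hi := Prod.ext (h.sq i hi) (h'.sq i hi)
  braid i hi := Prod.ext (h.braid i hi) (h'.braid i hi)
  comm i j hi hj := Prod.ext (h.comm i j hi hj) (h'.comm i j hi hj)

theorem CoxeterRelations.listProd_mem_normalForms {n : ℕ} {r : ℕ → M} (h : CoxeterRelations n r)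
    (l : List (Fin (n - 1))) : (l.map fun k : Fin (n - 1) => r k).prod ∈ normalForms n r := by
  induction l with
  | nil => exact one_mem_normalForms n r
  | cons k l ih => exact h.mul_mem_normalForms (by omega) ih

/-- The transposition of the letters `k` and `k + 1`, or the identity if there are no such
letters. -/
def natSwap (n k : ℕ) : Equiv.Perm (Fin n) :=
  if h : k < n - 1 then adjSwap n ⟨k, h⟩ else 1

theorem natSwap_val {n : ℕ} (k : Fin (n - 1)) : natSwap n k = adjSwap n k := by
  simp [natSwap]

theorem natSwap_apply {n k : ℕ} (h : k + 1 < n) (x : Fin n) :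
    ((natSwap n k x : Fin n) : ℕ) =
      if (x : ℕ) = k then k + 1 else if (x : ℕ) = k + 1 then k else x := by
  rw [natSwap, dif_pos (by omega), adjSwap, Equiv.swap_apply_def]
  simp only [Fin.ext_iff]
  split_ifs <;> rfl

theorem coxeterRelations_natSwap (n : ℕ) : CoxeterRelations n (natSwap n) where
  sq i hi := by
    ext x
    simp only [Equiv.Perm.mul_apply, natSwap_apply hi, Equiv.Perm.one_apply]
    split_ifs <;> omega
  braid i hi := by
    ext x
    simp only [Equiv.Perm.mul_apply, natSwap_apply (show i + 1 < n by omega),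
      natSwap_apply (show i + 1 + 1 < n by omega)]
    split_ifs <;> omega
  comm i j hi hj := by
    ext x
    simp only [Equiv.Perm.mul_apply, natSwap_apply (show i + 1 < n by omega), natSwap_apply hj]
    split_ifs <;> omega

theorem exists_adjSwap_listProd {n : ℕ} (π : Equiv.Perm (Fin n)) :
    ∃ l : List (Fin (n - 1)), (l.map (adjSwap n)).prod = π :=
  (exists_isReducedWord π).imp fun _ h => h.1

theorem mem_normalForms_natSwap {n : ℕ} (π : Equiv.Perm (Fin n)) :
    π ∈ normalForms n (natSwap n) := by
  obtain ⟨l, rfl⟩ := exists_adjSwap_listProd π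
  rw [show adjSwap n = fun k : Fin (n - 1) => natSwap n k from funext fun k => (natSwap_val k).symm]
  exact (coxeterRelations_natSwap n).listProd_mem_normalForms l

/-- There are as many normal forms as permutations, so each permutation has only one. -/
theorem nodup_normalForms_natSwap (n : ℕ) : (normalForms n (natSwap n)).Nodup := by
  refine Multiset.toFinset_card_eq_card_iff_nodup.1
    (?_ : (normalForms n (natSwap n)).toFinset.card = (normalForms n (natSwap n)).length)
  rw [length_normalForms, show (normalForms n (natSwap n)).toFinset = Finset.univ from
    Finset.eq_univ_of_forall fun π => List.mem_toFinset.2 (mem_normalForms_natSwap π)]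
  simp [Fintype.card_perm]

theorem map_fst_normalForms (n : ℕ) (r : ℕ → M) (r' : ℕ → M') :
    (normalForms n fun i => (r i, r' i)).map Prod.fst = normalForms n r :=
  map_normalForms (MonoidHom.fst M M') n _

theorem map_snd_normalForms (n : ℕ) (r : ℕ → M) (r' : ℕ → M') :
    (normalForms n fun i => (r i, r' i)).map Prod.snd = normalForms n r' :=
  map_normalForms (MonoidHom.snd M M') n _

/-- The value of a word in the generators `r k` occurs in the list of normal forms, paired with the
permutation that the word represents. -/
theorem CoxeterRelations.pair_mem_normalForms {n : ℕ} {r : ℕ → M} (h : CoxeterRelations n r)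
    (l : List (Fin (n - 1))) :
    ((l.map fun k : Fin (n - 1) => r k).prod, (l.map (adjSwap n)).prod) ∈
      normalForms n fun i => (r i, natSwap n i) := by
  have key : (l.map fun k : Fin (n - 1) => ((r k, natSwap n k) : M × Equiv.Perm (Fin n))).prod =
      ((l.map fun k : Fin (n - 1) => r k).prod, (l.map (adjSwap n)).prod) := by
    induction l with
    | nil => rfl
    | cons k l ih =>
      rw [List.map_cons, List.prod_cons, ih, natSwap_val]
      rfl
  rw [← key]
  exact (h.prod (coxeterRelations_natSwap n)).listProd_mem_normalForms l

theorem eq_of_mem_normalForms_natSwap {n : ℕ} {r : ℕ → M} {e e' : M × Equiv.Perm (Fin n)}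
    (he : e ∈ normalForms n fun i => (r i, natSwap n i))
    (he' : e' ∈ normalForms n fun i => (r i, natSwap n i)) (h : e.2 = e'.2) : e = e' := by
  have hnd := nodup_normalForms_natSwap n
  rw [← map_snd_normalForms n r] at hnd
  exact List.inj_on_of_nodup_map hnd he he' h

/-- The value of a word depends only on the permutation that the word represents: this is the
presentation of the symmetric group by the Coxeter relations. -/
theorem CoxeterRelations.listProd_eq {n : ℕ} {r : ℕ → M} (h : CoxeterRelations n r)
    {l l' : List (Fin (n - 1))} (hl : (l.map (adjSwap n)).prod = (l'.map (adjSwap n)).prod) :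
    (l.map fun k : Fin (n - 1) => r k).prod = (l'.map fun k : Fin (n - 1) => r k).prod :=
  congrArg Prod.fst (eq_of_mem_normalForms_natSwap (h.pair_mem_normalForms l)
    (h.pair_mem_normalForms l') hl)

/-- The sum over all permutations is the sum of the normal forms, whichever words `w π` represent
the permutations. -/
theorem CoxeterRelations.sum_eq {S : Type*} [Semiring S] {n : ℕ} {r : ℕ → S}
    (h : CoxeterRelations n r) (w : Equiv.Perm (Fin n) → List (Fin (n - 1)))
    (hw : ∀ π, ((w π).map (adjSwap n)).prod = π) :
    ∑ π, ((w π).map fun k : Fin (n - 1) => r k).prod = (normalForms n r).sum := by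
  have huniv : (normalForms n (natSwap n)).toFinset = Finset.univ :=
    Finset.eq_univ_of_forall fun π => List.mem_toFinset.2 (mem_normalForms_natSwap π)
  rw [← huniv, List.sum_toFinset _ (nodup_normalForms_natSwap n),
    ← map_snd_normalForms n r, ← map_fst_normalForms n r (natSwap n), List.map_map]
  congr 1
  refine List.map_congr_left fun e he => ?_
  have hmem := h.pair_mem_normalForms (w e.2)
  rw [hw] at hmem
  exact congrArg Prod.fst (eq_of_mem_normalForms_natSwap hmem he rfl)

theorem sum_normalForms_succ {S : Type*} [Semiring S] (n : ℕ) (r : ℕ → S) :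
    (normalForms (n + 1) r).sum =
      (∑ k ∈ Finset.range (n + 1), descProd r k) * (normalForms n fun i => r (i + 1)).sum := by
  have : ∀ L : List ℕ, (L.flatMap fun k =>
      (normalForms n fun i => r (i + 1)).map (descProd r k * ·)).sum =
      (L.map (descProd r)).sum * (normalForms n fun i => r (i + 1)).sum := by
    intro L
    induction L with
    | nil => simp
    | cons k L ih =>
      rw [List.flatMap_cons, List.sum_append, ih, List.map_cons, List.sum_cons, add_mul,
        List.sum_map_mul_left, List.map_id']
  rw [normalForms, this]
  rfl

theorem sum_descProd_succ {S : Type*} [Semiring S] (n : ℕ) (r : ℕ → S) :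
    ∑ k ∈ Finset.range (n + 1), descProd r k =
      1 + (∑ k ∈ Finset.range n, descProd (fun i => r (i + 1)) k) * r 0 := by
  rw [Finset.sum_range_succ', add_comm, Finset.sum_mul]
  simp_rw [descProd_succ']
  rfl

end Words

/-! ### Matrices on tensor powers -/

section TensorPowers

variable {I V : Type*} [Fintype I] [AddCommGroup V] [Module ℂ V]

/-- The action of a complex matrix on a column with entries in a complex vector space. -/
def act {m n : Type*} [Fintype n] (X : Matrix m n ℂ) (v : n → V) (x : m) : V :=
  ∑ y, X x y • v y

theorem act_mul {m n l : Type*} [Fintype n] [Fintype l] (X : Matrix m n ℂ) (Y : Matrix n l ℂ)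
    (v : l → V) : act (X * Y) v = act X (act Y v) := by
  funext x
  simp only [act, Matrix.mul_apply, Finset.sum_smul, Finset.smul_sum, smul_smul]
  exact Finset.sum_comm

theorem act_one {n : Type*} [Fintype n] [DecidableEq n] (v : n → V) :
    act (1 : Matrix n n ℂ) v = v := by
  funext x
  simp [act, Matrix.one_apply, ite_smul]

theorem act_add {m n : Type*} [Fintype n] (X Y : Matrix m n ℂ) (v : n → V) :
    act (X + Y) v = act X v + act Y v := by
  funext x
  simp [act, add_smul, Finset.sum_add_distrib]

theorem act_smul {m n : Type*} [Fintype n] (c : ℂ) (X : Matrix m n ℂ) (v : n → V) :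
    act (c • X) v = c • act X v := by
  funext x
  simp [act, mul_smul, Finset.smul_sum]

theorem eq_of_act_eq {m n : Type*} [Fintype n] [DecidableEq n] {X Y : Matrix m n ℂ}
    (h : ∀ v : n → ℂ, act X v = act Y v) : X = Y := by
  ext x y
  simpa [act, Pi.single_apply] using congrFun (h (Pi.single y 1)) x

theorem sum_cons {n : ℕ} {W : Type*} [AddCommMonoid W] (g : (Fin (n + 1) → I) → W) :
    ∑ x, g x = ∑ a, ∑ z : Fin n → I, g (Fin.cons a z) := by
  rw [← (Fin.consEquiv fun _ : Fin (n + 1) => I).sum_comp, Fintype.sum_prod_type]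
  rfl

omit [Fintype I] in
theorem exists_eq_cons {n : ℕ} (x : Fin (n + 1) → I) : ∃ a z, x = Fin.cons a z :=
  ⟨x 0, Fin.tail x, (Fin.cons_self_tail x).symm⟩

theorem act_act_comm {m n m' n' : Type*} [Fintype n] [Fintype n'] (X : Matrix m n ℂ)
    (Y : Matrix m' n' ℂ) (v : n → n' → V) (x : m) (x' : m') :
    act X (fun y => act Y (v y) x') x = act Y (fun y' => act X (fun y => v y y') x) x' := by
  simp only [act, Finset.smul_sum, smul_smul]
  rw [Finset.sum_comm]
  simp only [mul_comm]

variable [DecidableEq I]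

/-- The matrix `1 ⊗ X`. -/
def idTensor {n : ℕ} (X : Matrix (Fin n → I) (Fin n → I) ℂ) :
    Matrix (Fin (n + 1) → I) (Fin (n + 1) → I) ℂ :=
  Matrix.of fun x y => if x 0 = y 0 then X (Fin.tail x) (Fin.tail y) else 0

/-- The matrix `X ⊗ 1 ⊗ ⋯ ⊗ 1`, with `X` acting in the first two places. -/
def headTensor (n : ℕ) (X : Matrix (I × I) (I × I) ℂ) :
    Matrix (Fin (n + 2) → I) (Fin (n + 2) → I) ℂ :=
  Matrix.of fun x y =>
    if Fin.tail (Fin.tail x) = Fin.tail (Fin.tail y) then X (x 0, x 1) (y 0, y 1) else 0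

theorem act_idTensor {n : ℕ} (X : Matrix (Fin n → I) (Fin n → I) ℂ) (v : (Fin (n + 1) → I) → V)
    (a : I) (z : Fin n → I) :
    act (idTensor X) v (Fin.cons a z) = act X (fun w => v (Fin.cons a w)) z := by
  simp only [act, sum_cons, idTensor, Matrix.of_apply, Fin.cons_zero, Fin.tail_cons, ite_smul,
    zero_smul]
  rw [Finset.sum_eq_single a (fun b _ hb => by simp [Ne.symm hb]) (by simp)]
  simp

theorem act_headTensor {n : ℕ} (X : Matrix (I × I) (I × I) ℂ) (v : (Fin (n + 2) → I) → V)
    (a b : I) (z : Fin n → I) :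
    act (headTensor n X) v (Fin.cons a (Fin.cons b z)) =
      act X (fun q => v (Fin.cons q.1 (Fin.cons q.2 z))) (a, b) := by
  simp only [act, Fintype.sum_prod_type, sum_cons, headTensor, Matrix.of_apply,
    Fin.cons_zero, Fin.tail_cons, Fin.cons_one,
    ite_smul, zero_smul]
  simp

theorem idTensor_mul {n : ℕ} (X Y : Matrix (Fin n → I) (Fin n → I) ℂ) :
    idTensor (X * Y) = idTensor X * idTensor Y := by
  refine eq_of_act_eq fun v => ?_
  funext x
  obtain ⟨a, z, rfl⟩ := exists_eq_cons x
  simp only [act_mul, act_idTensor]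

theorem idTensor_one {n : ℕ} :
    idTensor (1 : Matrix (Fin n → I) (Fin n → I) ℂ) = 1 := by
  refine eq_of_act_eq fun v => ?_
  funext x
  obtain ⟨a, z, rfl⟩ := exists_eq_cons x
  simp only [act_one, act_idTensor]

/-- `X ↦ 1 ⊗ X` as a ring homomorphism. -/
def idTensorHom (I : Type*) [Fintype I] [DecidableEq I] (n : ℕ) :
    Matrix (Fin n → I) (Fin n → I) ℂ →+* Matrix (Fin (n + 1) → I) (Fin (n + 1) → I) ℂ where
  toFun := idTensor
  map_one' := idTensor_one
  map_mul' := idTensor_mul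
  map_zero' := by
    ext
    simp [idTensor]
  map_add' X Y := by
    ext x y
    simp only [idTensor, Matrix.of_apply, Matrix.add_apply]
    split_ifs <;> simp

theorem idTensorHom_apply {n : ℕ} (X : Matrix (Fin n → I) (Fin n → I) ℂ) :
    idTensorHom I n X = idTensor X := rfl

theorem headTensor_mul (n : ℕ) (X Y : Matrix (I × I) (I × I) ℂ) :
    headTensor n (X * Y) = headTensor n X * headTensor n Y := by
  refine eq_of_act_eq fun v => ?_
  funext x
  obtain ⟨a, x, rfl⟩ := exists_eq_cons x
  obtain ⟨b, z, rfl⟩ := exists_eq_cons x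
  simp only [act_mul, act_headTensor]

theorem headTensor_one (n : ℕ) : headTensor n (1 : Matrix (I × I) (I × I) ℂ) = 1 := by
  refine eq_of_act_eq fun v => ?_
  funext x
  obtain ⟨a, x, rfl⟩ := exists_eq_cons x
  obtain ⟨b, z, rfl⟩ := exists_eq_cons x
  simp only [act_one, act_headTensor]

theorem headTensor_comm {n : ℕ} (X : Matrix (I × I) (I × I) ℂ)
    (Y : Matrix (Fin n → I) (Fin n → I) ℂ) :
    headTensor n X * idTensor (idTensor Y) = idTensor (idTensor Y) * headTensor n X := by
  refine eq_of_act_eq fun v => ?_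
  funext x
  obtain ⟨a, x, rfl⟩ := exists_eq_cons x
  obtain ⟨b, z, rfl⟩ := exists_eq_cons x
  simp only [act_mul, act_headTensor, act_idTensor]
  exact act_act_comm X Y _ _ _

/-- The braid relation `(R ⊗ 1)(1 ⊗ R)(R ⊗ 1) = (1 ⊗ R)(R ⊗ 1)(1 ⊗ R)`, in terms of entries. -/
def IsBraiding (R : Matrix (I × I) (I × I) ℂ) : Prop :=
  ∀ a b c i j k, ∑ u, ∑ v, ∑ w, R (a, b) (u, v) * R (v, c) (w, k) * R (u, w) (i, j) =
    ∑ u, ∑ v, ∑ w, R (b, c) (u, v) * R (a, u) (i, w) * R (w, v) (j, k)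

theorem IsBraiding.headTensor {R : Matrix (I × I) (I × I) ℂ} (hR : IsBraiding R) (n : ℕ) :
    headTensor (n + 1) R * idTensor (headTensor n R) * headTensor (n + 1) R =
      idTensor (headTensor n R) * headTensor (n + 1) R * idTensor (headTensor n R) := by
  -- Both sides are sums over the three inner indices and the three final ones `i`, `j`, `k`;
  -- the final ones are moved to the front.
  have perm₁ (g : I → I → I → I → I → I → ℂ) :
      ∑ u, ∑ v, ∑ w, ∑ k, ∑ i, ∑ j, g u v w k i j =
        ∑ i, ∑ j, ∑ k, ∑ u, ∑ v, ∑ w, g u v w k i j := by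
    have := Fintype.sum_equiv (⟨fun x => (x.2.2.2.2.1, x.2.2.2.2.2, x.2.2.2.1, x.1, x.2.1, x.2.2.1),
      fun y => (y.2.2.2.1, y.2.2.2.2.1, y.2.2.2.2.2, y.2.2.1, y.1, y.2.1), fun _ => rfl,
      fun _ => rfl⟩ : (I × I × I × I × I × I) ≃ (I × I × I × I × I × I))
      (fun x => g x.1 x.2.1 x.2.2.1 x.2.2.2.1 x.2.2.2.2.1 x.2.2.2.2.2)
      (fun y => g y.2.2.2.1 y.2.2.2.2.1 y.2.2.2.2.2 y.2.2.1 y.1 y.2.1) (fun _ => rfl)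
    simpa only [Fintype.sum_prod_type] using this
  have perm₂ (g : I → I → I → I → I → I → ℂ) :
      ∑ u, ∑ v, ∑ i, ∑ w, ∑ j, ∑ k, g u v i w j k =
        ∑ i, ∑ j, ∑ k, ∑ u, ∑ v, ∑ w, g u v i w j k := by
    have := Fintype.sum_equiv (⟨fun x => (x.2.2.1, x.2.2.2.2.1, x.2.2.2.2.2, x.1, x.2.1, x.2.2.2.1),
      fun y => (y.2.2.2.1, y.2.2.2.2.1, y.1, y.2.2.2.2.2, y.2.1, y.2.2.1), fun _ => rfl,
      fun _ => rfl⟩ : (I × I × I × I × I × I) ≃ (I × I × I × I × I × I))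
      (fun x => g x.1 x.2.1 x.2.2.1 x.2.2.2.1 x.2.2.2.2.1 x.2.2.2.2.2)
      (fun y => g y.2.2.2.1 y.2.2.2.2.1 y.1 y.2.2.2.2.2 y.2.1 y.2.2.1) (fun _ => rfl)
    simpa only [Fintype.sum_prod_type] using this
  refine eq_of_act_eq fun v => ?_
  funext x
  obtain ⟨a, x, rfl⟩ := exists_eq_cons x
  obtain ⟨b, x, rfl⟩ := exists_eq_cons x
  obtain ⟨c, z, rfl⟩ := exists_eq_cons x
  simp only [act_mul, act_headTensor, act_idTensor]
  simp only [act, Fintype.sum_prod_type, Finset.smul_sum, smul_smul]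
  refine (perm₁ _).trans (Eq.trans ?_ (perm₂ _).symm)
  simp only [← Finset.sum_smul, ← mul_assoc]
  exact Finset.sum_congr rfl fun i _ => Finset.sum_congr rfl fun j _ =>
    Finset.sum_congr rfl fun k _ => by rw [hR a b c i j k]

/-- `R_k` for an arbitrary natural number `k`, equal to `1` when the places `k`, `k + 1` do not
exist. -/
def natRk (R : Matrix (I × I) (I × I) ℂ) (n k : ℕ) : Matrix (Fin n → I) (Fin n → I) ℂ :=
  if h : k < n - 1 then Rk R n ⟨k, h⟩ else 1

omit [Fintype I] in
theorem natRk_val (R : Matrix (I × I) (I × I) ℂ) {n : ℕ} (k : Fin (n - 1)) :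
    natRk R n k = Rk R n k := by
  simp [natRk]

omit [Fintype I] in
theorem natRk_zero (R : Matrix (I × I) (I × I) ℂ) (n : ℕ) :
    natRk R (n + 2) 0 = headTensor n R := by
  ext x y
  rw [natRk, dif_pos (by omega)]
  have : (∀ j : Fin (n + 2), j ≠ ⟨0, by omega⟩ → j ≠ ⟨0 + 1, by omega⟩ → x j = y j) ↔
      Fin.tail (Fin.tail x) = Fin.tail (Fin.tail y) := by
    constructor
    · intro h
      funext j
      exact h _ (by simp [Fin.ext_iff]) (by simp [Fin.ext_iff])
    · intro h j h0 h1
      have h0' : (j : ℕ) ≠ 0 := fun e => h0 (Fin.ext e)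
      have h1' : (j : ℕ) ≠ 1 := fun e => h1 (Fin.ext e)
      have hj : j = Fin.succ (Fin.succ ⟨j - 2, by omega⟩) :=
        Fin.ext (show (j : ℕ) = j - 2 + 1 + 1 by omega)
      rw [hj]
      exact congrFun h _
  simp only [Rk, headTensor, Matrix.of_apply, this]
  rfl

theorem natRk_succ (R : Matrix (I × I) (I × I) ℂ) (n k : ℕ) :
    natRk R (n + 1) (k + 1) = idTensor (natRk R n k) := by
  by_cases h : k < n - 1
  · rw [natRk, dif_pos (by omega), natRk, dif_pos h]
    ext x y
    have : (∀ j : Fin (n + 1), j ≠ ⟨k + 1, by omega⟩ → j ≠ ⟨k + 1 + 1, by omega⟩ → x j = y j) ↔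
        x 0 = y 0 ∧ ∀ j : Fin n, j ≠ ⟨k, by omega⟩ → j ≠ ⟨k + 1, by omega⟩ →
          Fin.tail x j = Fin.tail y j := by
      simp [Fin.forall_fin_succ, Fin.tail, Fin.ext_iff]
    simp only [Rk, idTensor, Matrix.of_apply, this, ite_and]
    rfl
  · rw [natRk, dif_neg (by omega), natRk, dif_neg h, idTensor_one]

theorem coxeterRelations_natRk {R : Matrix (I × I) (I × I) ℂ} (hR : IsBraiding R) (h2 : R ^ 2 = 1)
    (n : ℕ) : CoxeterRelations n (natRk R n) := by
  induction n with
  | zero => exact ⟨fun _ _ => by omega, fun _ _ => by omega, fun _ _ _ _ => by omega⟩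
  | succ n ih =>
    refine ⟨fun i hi => ?_, fun i hi => ?_, fun i j hi hj => ?_⟩
    · rcases i with _ | i
      · obtain ⟨m, rfl⟩ : ∃ m, n = m + 1 := ⟨n - 1, by omega⟩
        rw [natRk_zero, ← headTensor_mul, ← pow_two, h2, headTensor_one]
      · rw [natRk_succ, ← idTensor_mul, ih.sq i (by omega), idTensor_one]
    · rcases i with _ | i
      · obtain ⟨m, rfl⟩ : ∃ m, n = m + 2 := ⟨n - 2, by omega⟩
        rw [natRk_succ, natRk_zero, natRk_zero, hR.headTensor]
      · simp only [natRk_succ, ← idTensor_mul]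
        rw [ih.braid i (by omega)]
    · obtain ⟨j, rfl⟩ : ∃ m, j = m + 1 := ⟨j - 1, by omega⟩
      rcases i with _ | i
      · obtain ⟨j, rfl⟩ : ∃ m, j = m + 1 := ⟨j - 1, by omega⟩
        obtain ⟨m, rfl⟩ : ∃ m, n = m + 1 := ⟨n - 1, by omega⟩
        rw [natRk_succ, natRk_succ, natRk_zero, headTensor_comm]
      · simp only [natRk_succ, ← idTensor_mul]
        rw [ih.comm i j (by omega) (by omega)]

end TensorPowers

/-! ### The symmetrizer -/

section SymmetrizerLemmas

variable {I : Type*} [Fintype I] [DecidableEq I] {R : Matrix (I × I) (I × I) ℂ}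

theorem Rperm_eq (R : Matrix (I × I) (I × I) ℂ) {n : ℕ} (π : Equiv.Perm (Fin n)) :
    Rperm R π = ((reducedWord π).map fun k : Fin (n - 1) => natRk R n k).prod := by
  simp only [natRk_val]
  rfl

theorem prod_adjSwap_reducedWord {n : ℕ} (π : Equiv.Perm (Fin n)) :
    ((reducedWord π).map (adjSwap n)).prod = π :=
  (exists_isReducedWord π).choose_spec.1

theorem Rperm_mul (hR : IsBraiding R) (h2 : R ^ 2 = 1) {n : ℕ} (π σ : Equiv.Perm (Fin n)) :
    Rperm R π * Rperm R σ = Rperm R (π * σ) := by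
  rw [Rperm_eq, Rperm_eq, Rperm_eq, ← List.prod_append, ← List.map_append]
  refine (coxeterRelations_natRk hR h2 n).listProd_eq ?_
  simp [prod_adjSwap_reducedWord]

theorem symmetrizer_mul_Rperm (hR : IsBraiding R) (h2 : R ^ 2 = 1) {n : ℕ}
    (σ : Equiv.Perm (Fin n)) : symmetrizer R n * Rperm R σ = symmetrizer R n := by
  simp only [symmetrizer, Matrix.smul_mul, Matrix.sum_mul, Rperm_mul hR h2]
  exact congrArg _ (Equiv.sum_comp (Equiv.mulRight σ) (Rperm R))

theorem symmetrizer_mul_self (hR : IsBraiding R) (h2 : R ^ 2 = 1) (n : ℕ) :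
    symmetrizer R n * symmetrizer R n = symmetrizer R n := by
  have h : symmetrizer R n * ∑ π : Equiv.Perm (Fin n), Rperm R π =
      (n ! : ℂ) • symmetrizer R n := by
    rw [Matrix.mul_sum, Finset.sum_congr rfl fun π _ => symmetrizer_mul_Rperm hR h2 π]
    simp [Fintype.card_perm, Nat.cast_smul_eq_nsmul]
  have h0 : (n ! : ℂ) ≠ 0 := by exact_mod_cast n.factorial_ne_zero
  conv_lhs => rhs; rw [symmetrizer]
  rw [Matrix.mul_smul, h, inv_smul_smul₀ h0]

theorem isCompl_symmetrizer (hR : IsBraiding R) (h2 : R ^ 2 = 1) (n : ℕ) :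
    IsCompl (LinearMap.range (symmetrizer R n).mulVecLin)
      (LinearMap.range (1 - symmetrizer R n).mulVecLin) := by
  have hS := symmetrizer_mul_self hR h2 n
  set S := symmetrizer R n
  rw [isCompl_iff, Submodule.disjoint_def, codisjoint_iff, Submodule.eq_top_iff']
  refine ⟨?_, fun v => ?_⟩
  · rintro _ ⟨v, rfl⟩ ⟨w, hw⟩
    have := congrArg S.mulVec hw
    simp only [Matrix.mulVecLin_apply, Matrix.mulVec_mulVec, hS, mul_sub, mul_one, sub_self,
      Matrix.zero_mulVec] at this
    exact this.symm
  · rw [show v = S.mulVec v + (1 - S).mulVec v by simp [Matrix.sub_mulVec]]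
    exact Submodule.add_mem_sup ⟨v, rfl⟩ ⟨v, rfl⟩

/-- The sum of the normal forms of the words in the `R_k`. It is the sum of all `R_π` if `R` is an
involutive solution of the braid relation, but is defined, and has a recursion, for all `R`. -/
def braidedFactorial (R : Matrix (I × I) (I × I) ℂ) (n : ℕ) : Matrix (Fin n → I) (Fin n → I) ℂ :=
  (normalForms n (natRk R n)).sum

/-- The sum `1 + R_0 + R_1 R_0 + ⋯ + R_{n-2} ⋯ R_0`. -/
def braidedNumber (R : Matrix (I × I) (I × I) ℂ) (n : ℕ) : Matrix (Fin n → I) (Fin n → I) ℂ :=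
  ∑ k ∈ Finset.range n, descProd (natRk R n) k

theorem symmetrizer_eq (hR : IsBraiding R) (h2 : R ^ 2 = 1) (n : ℕ) :
    symmetrizer R n = (n ! : ℂ)⁻¹ • braidedFactorial R n := by
  rw [symmetrizer, braidedFactorial, ← (coxeterRelations_natRk hR h2 n).sum_eq reducedWord
    prod_adjSwap_reducedWord]
  simp only [Rperm_eq]

theorem braidedFactorial_zero (R : Matrix (I × I) (I × I) ℂ) : braidedFactorial R 0 = 1 := by
  simp [braidedFactorial, normalForms]

theorem braidedFactorial_succ (R : Matrix (I × I) (I × I) ℂ) (n : ℕ) :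
    braidedFactorial R (n + 1) = braidedNumber R (n + 1) * idTensor (braidedFactorial R n) := by
  rw [braidedFactorial, sum_normalForms_succ, braidedNumber, braidedFactorial,
    ← idTensorHom_apply, map_list_sum]
  simp only [natRk_succ, ← idTensorHom_apply]
  exact congrArg (_ * List.sum ·) (map_normalForms (idTensorHom I n).toMonoidHom n (natRk R n)).symm

theorem braidedNumber_one (R : Matrix (I × I) (I × I) ℂ) : braidedNumber R 1 = 1 := by
  simp [braidedNumber, descProd]

theorem braidedNumber_succ (R : Matrix (I × I) (I × I) ℂ) (n : ℕ) :
    braidedNumber R (n + 2) = 1 + idTensor (braidedNumber R (n + 1)) * headTensor n R := by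
  rw [braidedNumber, sum_descProd_succ, natRk_zero, braidedNumber, ← idTensorHom_apply, map_sum]
  simp only [natRk_succ, ← idTensorHom_apply]
  congr 2
  exact Finset.sum_congr rfl fun k _ =>
    (map_descProd (idTensorHom I (n + 1)).toMonoidHom (natRk R (n + 1)) k).symm

end SymmetrizerLemmas

/-! ### Words in the translations -/

section Translations

/-- The product `p_{x 0} ⋯ p_{x (n - 1)}`. -/
def wordProd {B I : Type*} [Ring B] (p : I → B) {n : ℕ} (x : Fin n → I) : B :=
  (List.ofFn fun k => p (x k)).prod

/-- The left `A`-submodule of `B` spanned by the words of length less than `n`. -/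
def lower (A : Type*) {B I : Type*} [Ring A] [Ring B] [Module A B] (p : I → B) (n : ℕ) :
    Submodule A B :=
  Submodule.span A {b | ∃ m < n, ∃ x : Fin m → I, b = wordProd p x}

/-- The image of `V ⊗ W` in `B ⊗ B`. -/
def tens {B : Type*} [Ring B] [Algebra ℂ B] (V W : Submodule ℂ B) : Submodule ℂ (B ⊗[ℂ] B) :=
  Submodule.map₂ (TensorProduct.mk ℂ B B) V W

section Elementary

variable {A B I : Type*} [Ring A] [Ring B] [Module A B] (p : I → B)

theorem wordProd_cons {n : ℕ} (s : I) (x : Fin n → I) :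
    wordProd p (Fin.cons s x) = p s * wordProd p x := by
  simp [wordProd, List.ofFn_succ]

theorem wordProd_zero (x : Fin 0 → I) : wordProd p x = 1 := by
  simp [wordProd]

theorem wordProd_mem_lower {m n : ℕ} (h : m < n) (x : Fin m → I) : wordProd p x ∈ lower A p n :=
  Submodule.subset_span ⟨m, h, x, rfl⟩

theorem lower_mono {m n : ℕ} (h : m ≤ n) : lower A p m ≤ lower A p n :=
  Submodule.span_mono fun _ ⟨k, hk, x, hx⟩ => ⟨k, by omega, x, hx⟩

theorem lower_zero : lower A p 0 = ⊥ := by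
  simp [lower]

theorem filtration_eq_lower (N : ℕ) : filtration A p N = lower A p (N + 1) := by
  simp only [filtration, lower, Nat.lt_succ_iff]
  rfl

end Elementary

section Tens

variable {B : Type*} [Ring B] [Algebra ℂ B]

theorem tmul_mem_tens {V W : Submodule ℂ B} {b c : B} (hb : b ∈ V) (hc : c ∈ W) :
    b ⊗ₜ[ℂ] c ∈ tens V W :=
  Submodule.apply_mem_map₂ _ hb hc

theorem tens_mono {V V' W W' : Submodule ℂ B} (hV : V ≤ V') (hW : W ≤ W') :
    tens V W ≤ tens V' W' :=
  Submodule.map₂_le_map₂ hV hW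

theorem tens_le_comap {C : Type*} [AddCommGroup C] [Module ℂ C] {V W : Submodule ℂ B}
    {X : Submodule ℂ C} {g : B ⊗[ℂ] B →ₗ[ℂ] C} (h : ∀ b ∈ V, ∀ c ∈ W, g (b ⊗ₜ c) ∈ X) :
    tens V W ≤ X.comap g :=
  Submodule.map₂_le.2 h

theorem tmul_mul_mem_tens {V V' W W' : Submodule ℂ B} {u v : B} (hu : ∀ b ∈ V, u * b ∈ V')
    (hv : ∀ c ∈ W, v * c ∈ W') {z : B ⊗[ℂ] B} (hz : z ∈ tens V W) :
    (u ⊗ₜ[ℂ] v) * z ∈ tens V' W' :=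
  tens_le_comap (X := tens V' W') (g := LinearMap.mulLeft ℂ (u ⊗ₜ[ℂ] v)) (fun b hb c hc => by
    rw [LinearMap.mulLeft_apply, Algebra.TensorProduct.tmul_mul_tmul]
    exact tmul_mem_tens (hu b hb) (hv c hc)) hz

/-- The map `id ⊗ h`. -/
def applyRight (h : B →ₗ[ℂ] ℂ) : B ⊗[ℂ] B →ₗ[ℂ] B :=
  (TensorProduct.rid ℂ B).toLinearMap ∘ₗ h.lTensor B

/-- The map `h ⊗ id`. -/
def applyLeft (h : B →ₗ[ℂ] ℂ) : B ⊗[ℂ] B →ₗ[ℂ] B :=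
  (TensorProduct.lid ℂ B).toLinearMap ∘ₗ h.rTensor B

@[simp]
theorem applyRight_tmul (h : B →ₗ[ℂ] ℂ) (b c : B) : applyRight h (b ⊗ₜ c) = h c • b := by
  simp [applyRight]

@[simp]
theorem applyLeft_tmul (h : B →ₗ[ℂ] ℂ) (b c : B) : applyLeft h (b ⊗ₜ c) = h b • c := by
  simp [applyLeft]

theorem applyRight_mem {V W : Submodule ℂ B} (h : B →ₗ[ℂ] ℂ) {z : B ⊗[ℂ] B} (hz : z ∈ tens V W) :
    applyRight h z ∈ V :=
  tens_le_comap (g := applyRight h) (fun b hb c _ => by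
    rw [applyRight_tmul]; exact V.smul_mem _ hb) hz

theorem applyLeft_mem {V W : Submodule ℂ B} (h : B →ₗ[ℂ] ℂ) {z : B ⊗[ℂ] B} (hz : z ∈ tens V W) :
    applyLeft h z ∈ W :=
  tens_le_comap (g := applyLeft h) (fun b _ c hc => by
    rw [applyLeft_tmul]; exact W.smul_mem _ hc) hz

end Tens

/-! ### Right coinvariants -/

section Hopf

variable {A : Type*} [Ring A] [HopfAlgebra ℂ A]

/-- The map `a ↦ (id ⊗ h) Δ a`. -/
def convLeft (h : A →ₗ[ℂ] ℂ) : A →ₗ[ℂ] A :=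
  (TensorProduct.rid ℂ A).toLinearMap ∘ₗ h.lTensor A ∘ₗ Coalgebra.comul

/-- `∑ S(a₁) a₂ h(a₃) = h(a)`. -/
theorem mul_antipode_convLeft (h : A →ₗ[ℂ] ℂ) (a : A) :
    LinearMap.mul' ℂ A (TensorProduct.map (HopfAlgebra.antipode ℂ) (convLeft h)
      (Coalgebra.comul (R := ℂ) a)) = h a • 1 := by
  let Ψ : A ⊗[ℂ] (A ⊗[ℂ] A) →ₗ[ℂ] A :=
    LinearMap.mul' ℂ A ∘ₗ TensorProduct.map (HopfAlgebra.antipode ℂ)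
      ((TensorProduct.rid ℂ A).toLinearMap ∘ₗ h.lTensor A)
  have h1 : LinearMap.mul' ℂ A ∘ₗ TensorProduct.map (HopfAlgebra.antipode ℂ) (convLeft h) =
      Ψ ∘ₗ (Coalgebra.comul (R := ℂ) (A := A)).lTensor A := by
    ext x y
    simp [Ψ, convLeft]
  have h2 : Ψ ∘ₗ (TensorProduct.assoc ℂ A A A).toLinearMap ∘ₗ
      (Coalgebra.comul (R := ℂ) (A := A)).rTensor A =
      LinearMap.mul' ℂ A ∘ₗ
        TensorProduct.map ((Algebra.linearMap ℂ A) ∘ₗ Coalgebra.counit)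
          (Algebra.linearMap ℂ A ∘ₗ h) := by
    have h3 (c : A) (z : A ⊗[ℂ] A) : Ψ (TensorProduct.assoc ℂ A A A (z ⊗ₜ c)) =
        h c • LinearMap.mul' ℂ A ((HopfAlgebra.antipode ℂ).rTensor A z) := by
      induction z with
      | zero => simp
      | tmul x y => simp [Ψ]
      | add x y hx hy => simp only [TensorProduct.add_tmul, map_add, hx, hy, smul_add]
    ext x y
    simp only [TensorProduct.AlgebraTensorModule.curry_apply, TensorProduct.curry_apply,
      LinearMap.coe_restrictScalars, LinearMap.comp_apply, LinearMap.rTensor_tmul,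
      LinearEquiv.coe_coe, h3, HopfAlgebra.mul_antipode_rTensor_comul_apply,
      TensorProduct.map_tmul, LinearMap.mul'_apply, Algebra.linearMap_apply]
    rw [Algebra.algebraMap_eq_smul_one (h y), mul_smul_comm, mul_one]
  have h4 := LinearMap.congr_fun h1 (Coalgebra.comul (R := ℂ) a)
  rw [LinearMap.comp_apply] at h4
  rw [h4, LinearMap.comp_apply, ← Coalgebra.coassoc_apply]
  have h5 := LinearMap.congr_fun h2 (Coalgebra.comul (R := ℂ) a)
  simp only [LinearMap.comp_apply, LinearEquiv.coe_coe] at h5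
  rw [h5]
  have h6 : LinearMap.mul' ℂ A ∘ₗ
      TensorProduct.map ((Algebra.linearMap ℂ A) ∘ₗ Coalgebra.counit)
        (Algebra.linearMap ℂ A ∘ₗ h) =
      Algebra.linearMap ℂ A ∘ₗ h ∘ₗ (TensorProduct.lid ℂ A).toLinearMap ∘ₗ
        (Coalgebra.counit (R := ℂ) (A := A)).rTensor A := by
    ext x y
    simp
  have h7 := LinearMap.congr_fun h6 (Coalgebra.comul (R := ℂ) a)
  rw [LinearMap.comp_apply] at h7
  rw [h7]
  simp [Coalgebra.rTensor_counit_comul, Algebra.algebraMap_eq_smul_one]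

/-- There is a linear `σ` with `∑ σ(a₂) a₁ = h(a)`, namely `σ(a) = ∑ S⁻¹(a₁ h(a₂))`. -/
theorem exists_extract (hS : Function.Bijective (HopfAlgebra.antipode ℂ (A := A)))
    (h : A →ₗ[ℂ] ℂ) : ∃ σ : A →ₗ[ℂ] A, ∀ a : A,
      LinearMap.mul' ℂ A (TensorProduct.comm ℂ A A (TensorProduct.map LinearMap.id σ
        (Coalgebra.comul (R := ℂ) a))) = h a • 1 := by
  let e := LinearEquiv.ofBijective (HopfAlgebra.antipode ℂ (A := A)) hS
  refine ⟨e.symm.toLinearMap ∘ₗ convLeft h, fun a => hS.1 ?_⟩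
  rw [map_smul, HopfAlgebra.antipode_one, ← mul_antipode_convLeft h a]
  generalize Coalgebra.comul (R := ℂ) a = z
  induction z with
  | zero => simp
  | tmul x y =>
    simp only [TensorProduct.map_tmul, TensorProduct.comm_tmul, LinearMap.mul'_apply,
      HopfAlgebra.antipode_mul_antidistrib, LinearMap.id_apply, LinearMap.comp_apply]
    congr 1
    exact e.apply_symm_apply _
  | add x y hx hy => simp only [map_add, hx, hy]

end Hopf

end Translations

/-! ### Inhomogeneous extensions: independence of the translations -/

section Bialgebra

variable {A B : Type*} [Ring A] [Bialgebra ℂ A] [Ring B] [Bialgebra ℂ B] (ι : A →ₐc[ℂ] B)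

/-- The image of `A` in `B`, as a complex subspace. -/
def imageA : Submodule ℂ B := LinearMap.range (ι : A →ₗ[ℂ] B)

variable {ι}

theorem apply_mem_imageA (a : A) : ι a ∈ imageA ι := ⟨a, rfl⟩

theorem mul_mem_imageA {b c : B} (hb : b ∈ imageA ι) (hc : c ∈ imageA ι) : b * c ∈ imageA ι := by
  obtain ⟨x, rfl⟩ := hb
  obtain ⟨y, rfl⟩ := hc
  exact ⟨x * y, map_mul ι x y⟩

theorem one_mem_imageA : (1 : B) ∈ imageA ι := ⟨1, map_one ι⟩

theorem comul_map (a : A) : Coalgebra.comul (R := ℂ) (ι a) =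
    TensorProduct.map (ι : A →ₗ[ℂ] B) (ι : A →ₗ[ℂ] B) (Coalgebra.comul (R := ℂ) a) :=
  (CoalgHomClass.map_comp_comul_apply ι a).symm

theorem comul_mem_tens_imageA (a : A) :
    Coalgebra.comul (R := ℂ) (ι a) ∈ tens (imageA ι) (imageA ι) := by
  rw [comul_map]
  generalize Coalgebra.comul (R := ℂ) a = z
  induction z with
  | zero => simp
  | tmul x y => exact tmul_mem_tens (apply_mem_imageA x) (apply_mem_imageA y)
  | add x y hx hy => rw [map_add]; exact add_mem hx hy

/-- If `V` and `W` are stable under left multiplication by `A`, then so is the image of `V ⊗ W`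
under left multiplication by `Δ(A)`. -/
theorem comul_mul_mem_tens {V W : Submodule ℂ B} (hV : ∀ (a : A), ∀ b ∈ V, ι a * b ∈ V)
    (hW : ∀ (a : A), ∀ b ∈ W, ι a * b ∈ W) (a : A) {z : B ⊗[ℂ] B} (hz : z ∈ tens V W) :
    Coalgebra.comul (R := ℂ) (ι a) * z ∈ tens V W := by
  rw [comul_map]
  generalize Coalgebra.comul (R := ℂ) a = w
  induction w with
  | zero => simp
  | tmul x y => exact tmul_mul_mem_tens (hV x) (hW y) hz
  | add x y hx hy => rw [map_add, add_mul]; exact add_mem hx hy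

theorem exists_retraction (hι : Function.Injective ι) :
    ∃ ρ : B →ₗ[ℂ] A, ∀ a, ρ (ι a) = a := by
  obtain ⟨ρ, hρ⟩ := LinearMap.exists_leftInverse_of_injective (ι : A →ₗ[ℂ] B)
    (LinearMap.ker_eq_bot.2 hι)
  exact ⟨ρ, fun a => LinearMap.congr_fun hρ a⟩

end Bialgebra

section Extension

variable {A B I : Type*} [Ring A] [HopfAlgebra ℂ A] [Ring B] [Bialgebra ℂ B] [Module A B]
  [Fintype I] [DecidableEq I] {Λ : Matrix I I A} {ι : A →ₐc[ℂ] B} {p : I → B}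

theorem IsInhomogeneousExtension.isScalarTower (hB : IsInhomogeneousExtension Λ ι p) :
    IsScalarTower ℂ A B where
  smul_assoc c a b := by rw [hB.smul_eq, hB.smul_eq, map_smul, smul_mul_assoc]

theorem IsInhomogeneousExtension.mul_mem_submodule (hB : IsInhomogeneousExtension Λ ι p)
    (L : Submodule A B) (a : A) {b : B} (hb : b ∈ L) : ι a * b ∈ L := by
  rw [← hB.smul_eq]
  exact L.smul_mem a hb

theorem IsInhomogeneousExtension.comul_p (hB : IsInhomogeneousExtension Λ ι p) (s : I) :
    Coalgebra.comul (R := ℂ) (p s) = ∑ j, ι (Λ s j) ⊗ₜ[ℂ] p j + p s ⊗ₜ[ℂ] 1 := by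
  simpa [Fintype.sum_sum_type] using hB.block.1 (Sum.inl s) (Sum.inr ())

theorem IsInhomogeneousExtension.mem_lower_one (hB : IsInhomogeneousExtension Λ ι p) {b : B} :
    b ∈ lower A p 1 ↔ b ∈ imageA ι := by
  have : lower A p 1 = Submodule.span A {(1 : B)} := by
    refine congrArg _ (Set.ext fun c => ⟨?_, ?_⟩)
    · rintro ⟨m, hm, x, rfl⟩
      obtain rfl : m = 0 := by omega
      simp [wordProd_zero]
    · rintro rfl
      exact ⟨0, by omega, finZeroElim, (wordProd_zero p _).symm⟩
  rw [this, Submodule.mem_span_singleton]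
  simp only [hB.smul_eq, mul_one]
  rfl

/-- The translations are linearly independent over the complex numbers, modulo `A`: the
coefficients of the combinations that lie in `A` form a subspace whose annihilator is invariant
under the irreducible representation `Λ`. -/
theorem IsInhomogeneousExtension.scalar_eq_zero (hB : IsInhomogeneousExtension Λ ι p)
    (hΛ : IsIrreducibleRep Λ) {c : I → ℂ} (hc : ∑ s, c s • p s ∈ imageA ι) : c = 0 := by
  let Φ : (I → ℂ) →ₗ[ℂ] B := Fintype.linearCombination ℂ p
  have hΦ (c : I → ℂ) : Φ c = ∑ s, c s • p s := Fintype.linearCombination_apply _ _ _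
  let W : Submodule ℂ (I → ℂ) := (imageA ι).comap Φ
  have hW {c : I → ℂ} : c ∈ W ↔ ∑ s, c s • p s ∈ imageA ι := by
    rw [← hΦ]; rfl
  obtain ⟨ρ, hρ⟩ := exists_retraction hB.injective
  have hinv (g : A →ₗ[ℂ] ℂ) {c : I → ℂ} (hc : c ∈ W) : Matrix.vecMul c (Λ.map g) ∈ W := by
    rw [hW] at hc ⊢
    obtain ⟨a, ha⟩ := hc
    have h1 := applyLeft_mem (g ∘ₗ ρ) (comul_mem_tens_imageA (ι := ι) a)
    have h2 : ι a = ∑ s, c s • p s := ha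
    rw [h2] at h1
    simp only [map_sum, map_smul, hB.comul_p, map_add, applyLeft_tmul, LinearMap.comp_apply, hρ,
      smul_add, Finset.sum_add_distrib, Finset.smul_sum] at h1
    have h3 : ∑ s, c s • (g ∘ₗ ρ) (p s) • (1 : B) ∈ imageA ι :=
      sum_mem fun s _ => Submodule.smul_mem _ _ (Submodule.smul_mem _ _ one_mem_imageA)
    have h4 := (Submodule.add_mem_iff_left _ h3).1 h1
    rw [Finset.sum_comm] at h4
    simpa [Matrix.vecMul, dotProduct, Finset.sum_smul, smul_smul] using h4
  -- `W'` is the annihilator of `W`: the row action of `Λ` on `W` is dual to its column action.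
  let W' : Submodule ℂ (I → ℂ) :=
    { carrier := {x | ∀ c ∈ W, c ⬝ᵥ x = 0}
      add_mem' := fun hx hy c hc => by rw [dotProduct_add, hx c hc, hy c hc, add_zero]
      zero_mem' := fun c _ => dotProduct_zero c
      smul_mem' := fun k x hx c hc => by rw [dotProduct_smul, hx c hc, smul_zero] }
  rcases hΛ.2.2 W' (fun g x hx c hc => by
    rw [Matrix.dotProduct_mulVec]; exact hx _ (hinv g hc)) with h | h
  · exfalso
    have hne : W < ⊤ := by
      refine lt_top_iff_ne_top.2 fun htop => ?_
      obtain ⟨i, hi⟩ := hB.notMem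
      have : Pi.single i (1 : ℂ) ∈ W := htop ▸ Submodule.mem_top
      rw [hW] at this
      simp only [Pi.single_apply, ite_smul, one_smul, zero_smul, Finset.sum_ite_eq',
        Finset.mem_univ, if_true] at this
      exact hi this
    obtain ⟨g, hg, hker⟩ := Submodule.exists_le_ker_of_lt_top W hne
    have hdot (c : I → ℂ) : c ⬝ᵥ (fun i => g fun j => if i = j then 1 else 0) = g c := by
      simp [LinearMap.pi_apply_eq_sum_univ g c, dotProduct]
    have : (fun i => g fun j => if i = j then 1 else 0) ∈ W' := fun c hc => by
      rw [hdot]; exact hker hc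
    rw [h, Submodule.mem_bot] at this
    refine hg (LinearMap.ext fun c => ?_)
    rw [← hdot, this, dotProduct_zero, LinearMap.zero_apply]
  · funext i
    have : Pi.single i (1 : ℂ) ∈ W' := h ▸ Submodule.mem_top
    simpa using this c (hW.2 hc)

/-- The functionals dual to the translations that vanish on `A`. -/
theorem IsInhomogeneousExtension.exists_dual (hB : IsInhomogeneousExtension Λ ι p)
    (hΛ : IsIrreducibleRep Λ) : ∃ h : I → B →ₗ[ℂ] ℂ, (∀ t, ∀ b ∈ imageA ι, h t b = 0) ∧
      ∀ t s, h t (p s) = if s = t then 1 else 0 := by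
  let Φ : (I → ℂ) →ₗ[ℂ] B ⧸ imageA ι := (imageA ι).mkQ ∘ₗ Fintype.linearCombination ℂ p
  obtain ⟨g, hg⟩ := LinearMap.exists_leftInverse_of_injective Φ (by
    refine LinearMap.ker_eq_bot'.2 fun c hc => hB.scalar_eq_zero hΛ ?_
    rw [← Fintype.linearCombination_apply]
    exact (Submodule.Quotient.mk_eq_zero _).1 hc)
  refine ⟨fun t => LinearMap.proj t ∘ₗ g ∘ₗ (imageA ι).mkQ, fun t b hb => ?_, fun t s => ?_⟩
  · have : (imageA ι).mkQ b = 0 := (Submodule.Quotient.mk_eq_zero _).2 hb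
    simp [this]
  · have := LinearMap.congr_fun hg (Pi.single s 1)
    have h2 : Φ (Pi.single s 1) = (imageA ι).mkQ (p s) := by
      simp [Φ, Fintype.linearCombination_apply_single]
    rw [LinearMap.comp_apply, h2] at this
    rw [LinearMap.comp_apply, LinearMap.comp_apply, this]
    simp [Pi.single_apply, eq_comm]

/-- The fundamental theorem of Hopf modules, in the form needed here: if the `q x` are right
coinvariant modulo `L`, then each relation between them over `A`, modulo `L`, is
composed of relations over the complex numbers. -/
theorem IsInhomogeneousExtension.extract (hB : IsInhomogeneousExtension Λ ι p)
    (hS : Function.Bijective (HopfAlgebra.antipode ℂ (A := A))) [IsScalarTower ℂ A B]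
    (L : Submodule A B)
    (hL : ∀ b ∈ L, Coalgebra.comul (R := ℂ) b ∈ tens (L.restrictScalars ℂ) ⊤)
    {J : Type*} [Fintype J] {q : J → B}
    (hq : ∀ x, Coalgebra.comul (R := ℂ) (q x) - q x ⊗ₜ[ℂ] 1 ∈ tens (L.restrictScalars ℂ) ⊤)
    {a : J → A} (ha : ∑ x, ι (a x) * q x ∈ L) (h : A →ₗ[ℂ] ℂ) : ∑ x, h (a x) • q x ∈ L := by
  obtain ⟨ρ, hρ⟩ := exists_retraction hB.injective
  obtain ⟨σ, hσ⟩ := exists_extract hS h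
  -- `T (b ⊗ c) = σ(c) b` preserves `L` in the first factor and takes `Δ(a) (b ⊗ 1)` to `h(a) b`.
  let T : B ⊗[ℂ] B →ₗ[ℂ] B := LinearMap.mul' ℂ B ∘ₗ (TensorProduct.comm ℂ B B).toLinearMap ∘ₗ
    TensorProduct.map LinearMap.id ((ι : A →ₗ[ℂ] B) ∘ₗ σ ∘ₗ ρ)
  have hT (b c : B) : T (b ⊗ₜ c) = ι (σ (ρ c)) * b := by simp [T]
  have hTL : tens (L.restrictScalars ℂ) ⊤ ≤ (L.restrictScalars ℂ).comap T :=
    tens_le_comap fun b hb c _ => by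
      rw [hT]; exact hB.mul_mem_submodule L _ hb
  have key (a : A) (b : B) : T (Coalgebra.comul (R := ℂ) (ι a) * b ⊗ₜ 1) = h a • b := by
    have : ι (LinearMap.mul' ℂ A (TensorProduct.comm ℂ A A (TensorProduct.map LinearMap.id σ
        (Coalgebra.comul (R := ℂ) a)))) * b = h a • b := by
      rw [hσ, map_smul, map_one, smul_mul_assoc, one_mul]
    rw [← this, comul_map]
    generalize Coalgebra.comul (R := ℂ) a = w
    induction w with
    | zero => simp
    | tmul x y =>
      simp only [TensorProduct.map_tmul, Algebra.TensorProduct.tmul_mul_tmul, mul_one, hT,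
        TensorProduct.comm_tmul, LinearMap.mul'_apply, map_mul, LinearMap.id_apply, ← mul_assoc]
      congr 3
      exact congrArg _ (hρ y)
    | add x y hx hy => simp only [map_add, add_mul, hx, hy]
  have h1 : ∑ x, Coalgebra.comul (R := ℂ) (ι (a x)) * q x ⊗ₜ[ℂ] 1 ∈
      tens (L.restrictScalars ℂ) ⊤ := by
    have h2 : ∑ x, Coalgebra.comul (R := ℂ) (ι (a x)) *
        (Coalgebra.comul (R := ℂ) (q x) - q x ⊗ₜ[ℂ] 1) ∈ tens (L.restrictScalars ℂ) ⊤ :=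
      sum_mem fun x _ => comul_mul_mem_tens (fun a b hb => hB.mul_mem_submodule L a hb)
        (fun _ _ _ => Submodule.mem_top) _ (hq x)
    have h3 := sub_mem (hL _ ha) h2
    simpa only [map_sum, Bialgebra.comul_mul, mul_sub, Finset.sum_sub_distrib,
      sub_sub_cancel] using h3
  have h4 := hTL h1
  simpa only [Submodule.mem_comap, map_sum, key, Submodule.restrictScalars_mem] using h4

/-- The translations are linearly independent over `A`, modulo `A`. -/
theorem IsInhomogeneousExtension.coeff_eq_zero (hB : IsInhomogeneousExtension Λ ι p)
    (hS : Function.Bijective (HopfAlgebra.antipode ℂ (A := A))) (hΛ : IsIrreducibleRep Λ)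
    {a : I → A} (ha : ∑ s, ι (a s) * p s ∈ imageA ι) : a = 0 := by
  have := hB.isScalarTower
  have himage {b : B} (hb : b ∈ imageA ι) : b ∈ (lower A p 1).restrictScalars ℂ :=
    hB.mem_lower_one.2 hb
  funext s
  refine (Module.forall_dual_apply_eq_zero_iff ℂ _).1 fun h => ?_
  refine congrFun (hB.scalar_eq_zero hΛ (c := fun s => h (a s)) ?_) s
  rw [← hB.mem_lower_one]
  refine hB.extract hS (lower A p 1) (fun b hb => ?_) (fun s => ?_) (hB.mem_lower_one.2 ha) h
  · obtain ⟨x, rfl⟩ := hB.mem_lower_one.1 hb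
    exact tens_mono (fun _ => himage) le_top (comul_mem_tens_imageA x)
  · rw [hB.comul_p, add_sub_cancel_right]
    exact sum_mem fun j _ => tmul_mem_tens (himage (apply_mem_imageA _)) Submodule.mem_top

end Extension

/-! ### The commutation relations -/

section Commutation

variable {A B I : Type*} [Ring A] [HopfAlgebra ℂ A] [Ring B] [Bialgebra ℂ B] [Module A B]
  [Fintype I] [DecidableEq I] {Λ : Matrix I I A} {ι : A →ₐc[ℂ] B} {p : I → B}
  {f : I → I → A →ₗ[ℂ] ℂ}

omit [Fintype I] [DecidableEq I] in
theorem counit_conv (a : A) (ρ : A →ₗ[ℂ] ℂ) : Coalgebra.counit (R := ℂ) (conv a ρ) = ρ a := by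
  have h : (Coalgebra.counit (R := ℂ) (A := A)) ∘ₗ (TensorProduct.lid ℂ A).toLinearMap ∘ₗ
      ρ.rTensor A = ρ ∘ₗ (TensorProduct.rid ℂ A).toLinearMap ∘ₗ
        (Coalgebra.counit (R := ℂ) (A := A)).lTensor A := by
    ext x y
    simp [mul_comm]
  have := LinearMap.congr_fun h (Coalgebra.comul (R := ℂ) a)
  simpa [Coalgebra.lTensor_counit_comul, conv] using this

theorem counit_convLeft (a : A) (h : A →ₗ[ℂ] ℂ) :
    Coalgebra.counit (R := ℂ) (convLeft h a) = h a := by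
  have h : (Coalgebra.counit (R := ℂ) (A := A)) ∘ₗ (TensorProduct.rid ℂ A).toLinearMap ∘ₗ
      h.lTensor A = h ∘ₗ (TensorProduct.lid ℂ A).toLinearMap ∘ₗ
        (Coalgebra.counit (R := ℂ) (A := A)).rTensor A := by
    ext x y
    simp [mul_comm]
  have := LinearMap.congr_fun h (Coalgebra.comul (R := ℂ) a)
  simpa [Coalgebra.rTensor_counit_comul, convLeft] using this

theorem apply_conv (a : A) (ρ h : A →ₗ[ℂ] ℂ) : h (conv a ρ) = ρ (convLeft h a) := by
  have h : h ∘ₗ (TensorProduct.lid ℂ A).toLinearMap ∘ₗ ρ.rTensor A =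
      ρ ∘ₗ (TensorProduct.rid ℂ A).toLinearMap ∘ₗ h.lTensor A := by
    ext x y
    simp [mul_comm]
  exact LinearMap.congr_fun h (Coalgebra.comul (R := ℂ) a)

theorem IsInhomogeneousExtension.exists_commutation (hB : IsInhomogeneousExtension Λ ι p)
    (s : I) (a : A) : ∃ c : I → A, p s * ι a - ∑ t, ι (c t) * p t ∈ imageA ι := by
  obtain ⟨y, hy, z, hz, hyz⟩ := Submodule.mem_sup.1 (hB.mul_mem (p s)
    (Submodule.mem_sup_left (Submodule.subset_span ⟨s, rfl⟩)) a)
  obtain ⟨c, rfl⟩ := (Submodule.mem_span_range_iff_exists_fun A).1 hy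
  obtain ⟨d, rfl⟩ := Submodule.mem_span_singleton.1 hz
  refine ⟨c, d, ?_⟩
  simp only [hB.smul_eq, mul_one] at hyz
  rw [← hyz, add_sub_cancel_left]
  rfl

theorem IsInhomogeneousExtension.coeff_unique (hB : IsInhomogeneousExtension Λ ι p)
    (hS : Function.Bijective (HopfAlgebra.antipode ℂ (A := A))) (hΛ : IsIrreducibleRep Λ)
    {b : B} {c d : I → A} (hc : b - ∑ t, ι (c t) * p t ∈ imageA ι)
    (hd : b - ∑ t, ι (d t) * p t ∈ imageA ι) : c = d := by
  refine sub_eq_zero.1 (hB.coeff_eq_zero hS hΛ ?_)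
  have := sub_mem hd hc
  simpa only [Pi.sub_apply, map_sub, sub_mul, Finset.sum_sub_distrib, sub_sub_sub_cancel_left]
    using this

/-- Existence and uniqueness of the functionals `f_st`. The coefficients `F_st(a)` with
`p_s a ≡ ∑ F_st(a) p_t` satisfy `Δ F_st = (F_st ⊗ id) Δ`, so that `F_st(a) = a * f_st` for
`f_st = ε ∘ F_st`. -/
theorem IsInhomogeneousExtension.existsUnique_commutationFamily
    (hB : IsInhomogeneousExtension Λ ι p)
    (hS : Function.Bijective (HopfAlgebra.antipode ℂ (A := A))) (hΛ : IsIrreducibleRep Λ) :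
    ∃! f : I → I → A →ₗ[ℂ] ℂ, IsCommutationFamily ι p f := by
  choose F hF using hB.exists_commutation
  obtain ⟨ρ, hρ⟩ := exists_retraction hB.injective
  have hadd (s : I) (a b : A) : F s (a + b) = F s a + F s b :=
    hB.coeff_unique hS hΛ (hF s _) (by
      have := add_mem (hF s a) (hF s b)
      simpa only [map_add, mul_add, Pi.add_apply, add_mul, Finset.sum_add_distrib,
        add_sub_add_comm] using this)
  have hsmul (s : I) (k : ℂ) (a : A) : F s (k • a) = k • F s a :=
    hB.coeff_unique hS hΛ (hF s _) (by
      have := Submodule.smul_mem _ k (hF s a)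
      simpa only [map_smul, mul_smul_comm, Pi.smul_apply, smul_mul_assoc, ← Finset.smul_sum,
        ← smul_sub] using this)
  have hcomul (h : A →ₗ[ℂ] ℂ) (b : B) (a : A) :
      applyRight (h ∘ₗ ρ) ((b ⊗ₜ 1) * Coalgebra.comul (R := ℂ) (ι a)) = b * ι (convLeft h a) ∧
      applyRight (h ∘ₗ ρ) (Coalgebra.comul (R := ℂ) (ι a) * (b ⊗ₜ 1)) = ι (convLeft h a) * b := by
    rw [comul_map, convLeft, LinearMap.comp_apply, LinearMap.comp_apply]
    generalize Coalgebra.comul (R := ℂ) a = z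
    induction z with
    | zero => simp
    | tmul x y => simp [hρ]
    | add x y hx hy =>
      simp only [map_add, mul_add, add_mul, hx, hy, true_and]
  -- Apply `id ⊗ h` to the coproduct of `p_s a ≡ ∑ F_st(a) p_t`.
  have hconv (h : A →ₗ[ℂ] ℂ) (s : I) (a : A) :
      F s (convLeft h a) = fun t => convLeft h (F s a t) := by
    refine hB.coeff_unique hS hΛ (hF s _) ?_
    obtain ⟨d, hd⟩ := hF s a
    have hd' : ι d = p s * ι a - ∑ t, ι (F s a t) * p t := hd
    have h1 := applyRight_mem (h ∘ₗ ρ) (comul_mem_tens_imageA (ι := ι) d)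
    have h2 (t : I) (a : A) : applyRight (h ∘ₗ ρ)
        ((∑ j, ι (Λ t j) ⊗ₜ[ℂ] p j) * Coalgebra.comul (R := ℂ) (ι a)) ∈ imageA ι := by
      simp only [Finset.sum_mul, map_sum]
      exact sum_mem fun j _ => applyRight_mem (W := ⊤) _ (tmul_mul_mem_tens
        (fun b hb => mul_mem_imageA (apply_mem_imageA _) hb) (fun _ _ => Submodule.mem_top)
        (comul_mem_tens_imageA a))
    have h3 (t : I) (a : A) : applyRight (h ∘ₗ ρ)
        (Coalgebra.comul (R := ℂ) (ι a) * (∑ j, ι (Λ t j) ⊗ₜ[ℂ] p j)) ∈ imageA ι := by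
      refine applyRight_mem (W := ⊤) _ (comul_mul_mem_tens (fun a b hb =>
        mul_mem_imageA (apply_mem_imageA a) hb) (fun _ _ _ => Submodule.mem_top) a ?_)
      exact sum_mem fun j _ => tmul_mem_tens (apply_mem_imageA _) Submodule.mem_top
    rw [hd'] at h1
    simp only [map_sub, Bialgebra.comul_mul, hB.comul_p, add_mul, mul_add, map_add, map_sum,
      Finset.sum_add_distrib, (hcomul _ _ _).1, (hcomul _ _ _).2] at h1
    have h4 := add_mem (sub_mem h1 (h2 s a))
      (sum_mem fun t (_ : t ∈ Finset.univ) => h3 t (F s a t))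
    convert h4 using 1
    abel
  let f : I → I → A →ₗ[ℂ] ℂ := fun s t =>
    { toFun := fun a => Coalgebra.counit (R := ℂ) (F s a t)
      map_add' := fun a b => by rw [hadd, Pi.add_apply, map_add]
      map_smul' := fun k a => by rw [hsmul, Pi.smul_apply, map_smul, RingHom.id_apply] }
  have hfF (s : I) (a : A) : (fun t => conv a (f s t)) = F s a := by
    funext t
    refine sub_eq_zero.1 ((Module.forall_dual_apply_eq_zero_iff ℂ _).1 fun h => ?_)
    rw [map_sub, apply_conv, sub_eq_zero]
    change Coalgebra.counit (R := ℂ) (F s (convLeft h a) t) = _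
    rw [hconv, counit_convLeft]
  refine ⟨f, fun s a => ?_, fun g hg => ?_⟩
  · have h1 := hF s a
    rw [← hfF] at h1
    exact h1
  · funext s t
    refine LinearMap.ext fun a => ?_
    have h1 := hB.coeff_unique hS hΛ (hF s a) (hg s a)
    rw [← counit_conv a (g s t), ← congrFun h1 t]
    rfl

/-- `f` is a representation of the algebra `A`. -/
theorem IsInhomogeneousExtension.family_mul (hB : IsInhomogeneousExtension Λ ι p)
    (hS : Function.Bijective (HopfAlgebra.antipode ℂ (A := A))) (hΛ : IsIrreducibleRep Λ)
    (hf : IsCommutationFamily ι p f) (s r : I) (a b : A) :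
    f s r (a * b) = ∑ t, f s t a * f t r b := by
  have h1 := hf s (a * b)
  have h2 : p s * ι (a * b) - ∑ r, ι (∑ t, conv a (f s t) * conv b (f t r)) * p r ∈ imageA ι := by
    have h3 := add_mem (mul_mem_imageA (hf s a) (apply_mem_imageA (ι := ι) b))
      (sum_mem fun t (_ : t ∈ Finset.univ) =>
        mul_mem_imageA (apply_mem_imageA (ι := ι) (conv a (f s t))) (hf t b))
    convert h3 using 1
    simp only [map_mul, map_sum, sub_mul, mul_sub, Finset.sum_mul, Finset.mul_sum, ← mul_assoc,
      Finset.sum_sub_distrib]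
    rw [sub_add_sub_cancel]
    rw [Finset.sum_comm]
  have h3 := congrArg (Coalgebra.counit (R := ℂ)) (congrFun (hB.coeff_unique hS hΛ h1 h2) r)
  simpa only [counit_conv, map_sum, Bialgebra.counit_mul] using h3

theorem conv_rep (hΛ : IsRepresentation Λ) (ρ : A →ₗ[ℂ] ℂ) (k m : I) :
    conv (Λ k m) ρ = ∑ n, ρ (Λ k n) • Λ n m := by
  simp [conv, hΛ.1]

omit [Module A B] in
/-- `p_s Λ_km ≡ ∑ R_{sk,nj} Λ_nm p_j` modulo `A`. -/
theorem IsCommutationFamily.p_mul_rep (hf : IsCommutationFamily ι p f) (hΛ : IsRepresentation Λ)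
    (s k m : I) :
    p s * ι (Λ k m) - ∑ n, ∑ j, RMatrix f Λ (s, k) (n, j) • (ι (Λ n m) * p j) ∈ imageA ι := by
  have := hf s (Λ k m)
  simp only [conv_rep hΛ, map_sum, map_smul, Finset.sum_mul, smul_mul_assoc] at this
  rw [Finset.sum_comm] at this
  exact this

/-- `R` intertwines `Λ ⊗ Λ` with itself: compare the coproducts of both sides of the relation
`p_s Λ_km ≡ ∑ R_{sk,nj} Λ_nm p_j`, modulo `A` in the second factor. -/
theorem IsInhomogeneousExtension.rep_mul_RMatrix (hB : IsInhomogeneousExtension Λ ι p)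
    (hS : Function.Bijective (HopfAlgebra.antipode ℂ (A := A))) (hΛ : IsIrreducibleRep Λ)
    (hf : IsCommutationFamily ι p f) (s k u t : I) :
    ∑ j, ∑ n, RMatrix f Λ (j, n) (u, t) • (Λ s j * Λ k n) =
      ∑ n, ∑ j, RMatrix f Λ (s, k) (n, j) • (Λ n u * Λ j t) := by
  set R := RMatrix f Λ
  obtain ⟨ρ, hρ⟩ := exists_retraction hB.injective
  refine sub_eq_zero.1 ((Module.forall_dual_apply_eq_zero_iff ℂ _).1 fun h => ?_)
  have hcomulΛ (k m : I) : Coalgebra.comul (R := ℂ) (ι (Λ k m)) =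
      ∑ n, ι (Λ k n) ⊗ₜ[ℂ] ι (Λ n m) := by
    rw [comul_map, hΛ.1.1]
    simp
  let Z (u t : I) : ℂ := h (∑ j, ∑ n, R (j, n) (u, t) • (Λ s j * Λ k n) -
      ∑ n, ∑ j, R (s, k) (n, j) • (Λ n u * Λ j t))
  suffices hZ : ∀ m, (fun t => ∑ u, Z u t • Λ u m) = 0 by
    have := congrArg (Coalgebra.counit (R := ℂ)) (congrFun (hZ u) t)
    simp only [map_sum, map_smul, hΛ.1.2, Matrix.one_apply, smul_eq_mul, mul_ite, mul_one, mul_zero,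
      Finset.sum_ite_eq', Finset.mem_univ, if_true, Pi.zero_apply, map_zero] at this
    exact this
  intro m
  refine hB.coeff_eq_zero hS hΛ ?_
  obtain ⟨d, hd⟩ := hf.p_mul_rep hΛ.1 s k m
  have hd' : ι d = p s * ι (Λ k m) - ∑ n, ∑ j, R (s, k) (n, j) • (ι (Λ n m) * p j) := hd
  let Q := (imageA ι).mkQ
  have hQ {b : B} : Q b = 0 ↔ b ∈ imageA ι := Submodule.Quotient.mk_eq_zero _
  have h1 := hQ.2 (applyLeft_mem (h ∘ₗ ρ) (comul_mem_tens_imageA (ι := ι) d))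
  have hQ₁ (j n : I) : Q (p j * ι (Λ n m)) =
      ∑ u, ∑ t, R (j, n) (u, t) • Q (ι (Λ u m) * p t) := by
    have := hQ.2 (hf.p_mul_rep hΛ.1 j n m)
    rw [map_sub, sub_eq_zero] at this
    simpa only [map_sum, map_smul] using this
  have hQ₂ (u : I) : Q (ι (Λ u m)) = 0 := hQ.2 (apply_mem_imageA _)
  have hρ₂ (a b : A) : ρ (ι a * ι b) = a * b := by rw [← map_mul, hρ]
  rw [hd'] at h1
  simp only [map_sub, map_sum, map_smul, Bialgebra.comul_mul, hB.comul_p, hcomulΛ, add_mul, mul_add,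
    Finset.sum_mul, Finset.mul_sum, map_add, Algebra.TensorProduct.tmul_mul_tmul, applyLeft_tmul,
    LinearMap.comp_apply, hρ₂, one_mul, mul_one, hQ₁, hQ₂, smul_zero, Finset.sum_const_zero,
    add_zero] at h1
  have hcomm (g : I → I → I → I → B ⧸ imageA ι) :
      ∑ j, ∑ n, ∑ u, ∑ t, g j n u t = ∑ t, ∑ u, ∑ j, ∑ n, g j n u t := by
    have := Fintype.sum_equiv (⟨fun x => (x.2.2.2, x.2.2.1, x.1, x.2.1),
      fun y => (y.2.2.1, y.2.2.2, y.2.1, y.1), fun _ => rfl, fun _ => rfl⟩ :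
        (I × I × I × I) ≃ (I × I × I × I))
      (fun x => g x.1 x.2.1 x.2.2.1 x.2.2.2) (fun y => g y.2.2.1 y.2.2.2 y.2.1 y.1) (fun _ => rfl)
    simpa only [Fintype.sum_prod_type] using this
  rw [← hQ]
  simp only [map_sum, map_smul, Finset.sum_mul, smul_mul_assoc, Z, map_sub, sub_smul,
    sub_mul, Finset.sum_sub_distrib, Finset.sum_smul, smul_eq_mul]
  simp only [Finset.smul_sum, smul_smul] at h1
  rw [sub_eq_zero] at h1 ⊢
  refine Eq.trans ?_ (h1.trans ?_)
  · refine (hcomm _).symm.trans (Finset.sum_comm.trans ?_)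
    simp only [mul_comm]
  · refine Eq.trans ?_ (hcomm _)
    exact Finset.sum_congr rfl fun _ _ => Finset.sum_congr rfl fun _ _ => Finset.sum_comm

/-- The braid relation for `R` arises by applying `f` to the intertwining property of `R`. -/
theorem IsInhomogeneousExtension.isBraiding (hB : IsInhomogeneousExtension Λ ι p)
    (hS : Function.Bijective (HopfAlgebra.antipode ℂ (A := A))) (hΛ : IsIrreducibleRep Λ)
    (hf : IsCommutationFamily ι p f) : IsBraiding (RMatrix f Λ) := by
  have hfR (a s j c : I) : f a c (Λ s j) = RMatrix f Λ (a, s) (j, c) := rfl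
  intro a s k m t b
  have := congrArg (f a b) (hB.rep_mul_RMatrix hS hΛ hf s k m t)
  simp only [map_sum, map_smul, hB.family_mul hS hΛ hf, hfR, smul_eq_mul] at this
  simp only [Finset.mul_sum] at this
  calc _ = _ := Finset.sum_congr rfl fun u _ => (Finset.sum_comm).trans
        (Finset.sum_congr rfl fun w _ => Finset.sum_congr rfl fun v _ => by ring)
    _ = _ := this
    _ = _ := Finset.sum_congr rfl fun u _ => Finset.sum_congr rfl fun v _ =>
        Finset.sum_congr rfl fun w _ => by ring

end Commutation

/-! ### The coproduct of words and the braided factorial -/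

section Coproduct

theorem act_mem {m n V : Type*} [Fintype n] [AddCommGroup V] [Module ℂ V] (L : Submodule ℂ V)
    (X : Matrix m n ℂ) {v : n → V} (hv : ∀ y, v y ∈ L) (x : m) : act X v x ∈ L :=
  sum_mem fun y _ => L.smul_mem _ (hv y)

theorem map_act {m n V W : Type*} [Fintype n] [AddCommGroup V] [Module ℂ V] [AddCommGroup W]
    [Module ℂ W] (g : V →ₗ[ℂ] W) (X : Matrix m n ℂ) (v : n → V) (x : m) :
    g (act X v x) = act X (fun y => g (v y)) x := by
  simp [act]

theorem act_sub {m n V : Type*} [Fintype n] [AddCommGroup V] [Module ℂ V]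
    (X : Matrix m n ℂ) (v w : n → V) : act X (fun y => v y - w y) = act X v - act X w := by
  funext x
  simp [act, smul_sub]

theorem sum_smul_act {m n V : Type*} [Fintype m] [Fintype n] [AddCommGroup V] [Module ℂ V]
    (c : m → ℂ) (X : Matrix m n ℂ) (v : n → V) :
    ∑ x, c x • act X v x = ∑ y, Matrix.vecMul c X y • v y := by
  simp only [act, Matrix.vecMul, dotProduct, Finset.smul_sum, Finset.sum_smul, smul_smul]
  exact Finset.sum_comm

variable {A B I : Type*} [Ring A] [HopfAlgebra ℂ A] [Ring B] [Bialgebra ℂ B] [Module A B]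
  [Fintype I] [DecidableEq I] {Λ : Matrix I I A} {ι : A →ₐc[ℂ] B} {p : I → B}
  {f : I → I → A →ₗ[ℂ] ℂ}

theorem IsInhomogeneousExtension.p_mul_mem_lower (hB : IsInhomogeneousExtension Λ ι p) (s : I)
    {n : ℕ} {b : B} (hb : b ∈ lower A p n) : p s * b ∈ lower A p (n + 1) := by
  induction hb using Submodule.span_induction generalizing s with
  | zero => simp
  | add b c _ _ hb hc =>
    rw [mul_add]
    exact add_mem (hb s) (hc s)
  | mem b hb =>
    obtain ⟨m, hm, x, rfl⟩ := hb
    rw [← wordProd_cons]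
    exact wordProd_mem_lower p (by omega) _
  | smul a b hb h =>
    obtain ⟨c, d, hd⟩ := hB.exists_commutation s a
    have hd' : p s * ι a = ι d + ∑ t, ι (c t) * p t := eq_add_of_sub_eq hd.symm
    rw [hB.smul_eq, ← mul_assoc, hd', add_mul, Finset.sum_mul]
    refine add_mem (hB.mul_mem_submodule _ _ (lower_mono p (Nat.le_succ n) hb))
      (sum_mem fun t _ => ?_)
    rw [mul_assoc]
    exact hB.mul_mem_submodule _ _ (h t)

variable [IsScalarTower ℂ A B]

/-- The complex subspace underlying `lower A p n`. -/
abbrev lowerC (A : Type*) {B I : Type*} [Ring A] [Algebra ℂ A] [Ring B] [Algebra ℂ B] [Module A B]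
    [IsScalarTower ℂ A B] (p : I → B) (n : ℕ) : Submodule ℂ B :=
  (lower A p n).restrictScalars ℂ

omit [Fintype I] [DecidableEq I] in
theorem lowerC_mono {m n : ℕ} (h : m ≤ n) : lowerC A p m ≤ lowerC A p n :=
  fun _ hx => lower_mono p h hx

/-- Words are right coinvariant, up to shorter words. -/
theorem IsInhomogeneousExtension.comul_wordProd (hB : IsInhomogeneousExtension Λ ι p) {n : ℕ}
    (x : Fin n → I) : Coalgebra.comul (R := ℂ) (wordProd p x) - wordProd p x ⊗ₜ[ℂ] 1 ∈
      tens (lowerC A p n) ⊤ := by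
  induction n with
  | zero => simp [wordProd_zero, Algebra.TensorProduct.one_def]
  | succ n ih =>
    obtain ⟨s, x, rfl⟩ := exists_eq_cons x
    rw [wordProd_cons, Bialgebra.comul_mul]
    obtain ⟨K, hK⟩ : ∃ K, Coalgebra.comul (R := ℂ) (wordProd p x) - wordProd p x ⊗ₜ[ℂ] 1 = K :=
      ⟨_, rfl⟩
    have hK' := ih x
    rw [hK] at hK'
    rw [eq_add_of_sub_eq hK, hB.comul_p]
    have h1 : ∑ j, ι (Λ s j) ⊗ₜ[ℂ] p j * wordProd p x ⊗ₜ[ℂ] 1 ∈ tens (lowerC A p (n + 1)) ⊤ :=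
      sum_mem fun j _ => by
        rw [Algebra.TensorProduct.tmul_mul_tmul]
        exact tmul_mem_tens (hB.mul_mem_submodule _ _ (wordProd_mem_lower p (Nat.lt_succ_self n) x))
          Submodule.mem_top
    have h2 : ∑ j, ι (Λ s j) ⊗ₜ[ℂ] p j * K ∈ tens (lowerC A p (n + 1)) ⊤ :=
      sum_mem fun j _ => tmul_mul_mem_tens (fun b hb =>
        lower_mono (A := A) p (Nat.le_succ n) (hB.mul_mem_submodule _ _ hb))
        (fun _ _ => Submodule.mem_top) hK'
    have h3 : p s ⊗ₜ[ℂ] 1 * K ∈ tens (lowerC A p (n + 1)) ⊤ :=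
      tmul_mul_mem_tens (fun b hb => hB.p_mul_mem_lower s hb) (fun _ _ => Submodule.mem_top) hK'
    convert add_mem (add_mem h1 h2) h3 using 1
    rw [add_mul, mul_add, mul_add, Finset.sum_mul, Finset.sum_mul,
      Algebra.TensorProduct.tmul_mul_tmul (p s), mul_one]
    abel

omit [IsScalarTower ℂ A B] in
theorem IsInhomogeneousExtension.comul_mem_tens_of_wordProd (hB : IsInhomogeneousExtension Λ ι p)
    {n : ℕ} {T : Submodule ℂ (B ⊗[ℂ] B)}
    (hT : ∀ a, ∀ z ∈ T, Coalgebra.comul (R := ℂ) (ι a) * z ∈ T)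
    (h : ∀ m < n, ∀ x : Fin m → I, Coalgebra.comul (R := ℂ) (wordProd p x) ∈ T) {b : B}
    (hb : b ∈ lower A p n) : Coalgebra.comul (R := ℂ) b ∈ T := by
  induction hb using Submodule.span_induction with
  | zero => simp
  | add b c _ _ hb hc => rw [map_add]; exact add_mem hb hc
  | mem b hb =>
    obtain ⟨m, hm, x, rfl⟩ := hb
    exact h m hm x
  | smul a b _ h =>
    rw [hB.smul_eq, Bialgebra.comul_mul]
    exact hT _ _ h

theorem IsInhomogeneousExtension.comul_mem_lower (hB : IsInhomogeneousExtension Λ ι p) {n : ℕ}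
    {b : B} (hb : b ∈ lower A p n) : Coalgebra.comul (R := ℂ) b ∈ tens (lowerC A p n) ⊤ := by
  refine hB.comul_mem_tens_of_wordProd (fun a z hz => comul_mul_mem_tens
    (fun a b hb => hB.mul_mem_submodule _ a hb) (fun _ _ _ => Submodule.mem_top) a hz)
    (fun m hm x => ?_) hb
  have h1 := tens_mono (lowerC_mono hm.le) le_rfl (hB.comul_wordProd x)
  have h2 : wordProd p x ⊗ₜ[ℂ] (1 : B) ∈ tens (lowerC A p n) ⊤ :=
    tmul_mem_tens (wordProd_mem_lower p hm x) Submodule.mem_top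
  simpa using add_mem h1 h2

/-- The terms of the coproduct of an element of degree at most `n` that have degree `n` in the
first factor have degree `0` in the second one. -/
theorem IsInhomogeneousExtension.comul_mem_lower_succ (hB : IsInhomogeneousExtension Λ ι p) {n : ℕ}
    {b : B} (hb : b ∈ lower A p (n + 1)) : Coalgebra.comul (R := ℂ) b ∈
      tens ⊤ (imageA ι) ⊔ tens (lowerC A p n) ⊤ := by
  refine hB.comul_mem_tens_of_wordProd (fun a z hz => ?_) (fun m hm x => ?_) hb
  · obtain ⟨u, hu, v, hv, rfl⟩ := Submodule.mem_sup.1 hz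
    rw [mul_add]
    exact Submodule.add_mem_sup
      (comul_mul_mem_tens (fun _ _ _ => Submodule.mem_top)
        (fun a b hb => mul_mem_imageA (apply_mem_imageA a) hb) a hu)
      (comul_mul_mem_tens (fun a b hb => hB.mul_mem_submodule _ a hb)
        (fun _ _ _ => Submodule.mem_top) a hv)
  · have h1 := tens_mono (lowerC_mono (Nat.le_of_lt_succ hm)) le_rfl (hB.comul_wordProd x)
    have h2 : wordProd p x ⊗ₜ[ℂ] (1 : B) ∈ tens ⊤ (imageA ι) :=
      tmul_mem_tens Submodule.mem_top one_mem_imageA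
    simpa using Submodule.add_mem_sup h2 h1

/-- The column with entries `Λ_{y₀ t} p_{y₁} ⋯ p_{yₙ}`. -/
def repWord (Λ : Matrix I I A) (ι : A →ₐc[ℂ] B) (p : I → B) (n : ℕ) (t : I)
    (y : Fin (n + 1) → I) : B :=
  ι (Λ (y 0) t) * wordProd p (Fin.tail y)

omit [Module A B] [IsScalarTower ℂ A B] [Fintype I] [DecidableEq I] in
theorem repWord_cons {n : ℕ} (t a : I) (z : Fin n → I) :
    repWord Λ ι p n t (Fin.cons a z) = ι (Λ a t) * wordProd p z := by
  simp [repWord]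

theorem IsInhomogeneousExtension.repWord_mem (hB : IsInhomogeneousExtension Λ ι p) {n : ℕ} (t : I)
    (y : Fin (n + 1) → I) : repWord Λ ι p n t y ∈ lowerC A p (n + 1) :=
  hB.mul_mem_submodule _ _ (wordProd_mem_lower p (Nat.lt_succ_self n) _)

/-- The terms of the coproduct of a word that have degree `1` in the second factor. Moving the
entries of `Λ` to the left past the translations costs factors `R`, by the commutation
relations. -/
theorem IsInhomogeneousExtension.comul_wordProd_succ (hB : IsInhomogeneousExtension Λ ι p)
    (hΛ : IsRepresentation Λ) (hf : IsCommutationFamily ι p f) {n : ℕ} (x : Fin (n + 1) → I) :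
    Coalgebra.comul (R := ℂ) (wordProd p x) - wordProd p x ⊗ₜ[ℂ] 1 -
      ∑ t, act (braidedNumber (RMatrix f Λ) (n + 1)) (repWord Λ ι p n t) x ⊗ₜ[ℂ] p t ∈
        tens (lowerC A p n) ⊤ := by
  set R := RMatrix f Λ
  induction n with
  | zero =>
    obtain ⟨s, x, rfl⟩ := exists_eq_cons x
    simp [braidedNumber_one, act_one, repWord_cons, wordProd_cons, wordProd_zero, hB.comul_p]
  | succ n ih =>
    obtain ⟨s, x, rfl⟩ := exists_eq_cons x
    let C := braidedNumber R (n + 1)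
    let G (t : I) : B := act C (repWord Λ ι p n t) x
    obtain ⟨K, hK⟩ : ∃ K, Coalgebra.comul (R := ℂ) (wordProd p x) - wordProd p x ⊗ₜ[ℂ] 1 -
      ∑ t, G t ⊗ₜ[ℂ] p t = K := ⟨_, rfl⟩
    have hK' := ih x
    rw [hK] at hK'
    have hK₂ : Coalgebra.comul (R := ℂ) (wordProd p x) =
        K + ∑ t, G t ⊗ₜ[ℂ] p t + wordProd p x ⊗ₜ[ℂ] 1 := by
      rw [← hK]
      abel
    have hG (t : I) : G t ∈ lowerC A p (n + 1) := act_mem _ _ (hB.repWord_mem t) x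
    have h1 : ∑ t, ∑ r, ι (Λ s r) ⊗ₜ[ℂ] p r * G t ⊗ₜ[ℂ] p t ∈ tens (lowerC A p (n + 1)) ⊤ :=
      sum_mem fun t _ => sum_mem fun r _ => by
        rw [Algebra.TensorProduct.tmul_mul_tmul]
        exact tmul_mem_tens (hB.mul_mem_submodule _ _ (hG t)) Submodule.mem_top
    have h2 : ∑ r, ι (Λ s r) ⊗ₜ[ℂ] p r * K ∈ tens (lowerC A p (n + 1)) ⊤ :=
      sum_mem fun j _ => tmul_mul_mem_tens (fun b hb =>
        lower_mono (A := A) p (Nat.le_succ n) (hB.mul_mem_submodule _ _ hb))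
        (fun _ _ => Submodule.mem_top) hK'
    have h3 : p s ⊗ₜ[ℂ] 1 * K ∈ tens (lowerC A p (n + 1)) ⊤ :=
      tmul_mul_mem_tens (fun b hb => hB.p_mul_mem_lower s hb) (fun _ _ => Submodule.mem_top) hK'
    let H (t : I) : B := act C (fun w => act (headTensor n R) (repWord Λ ι p (n + 1) t)
      (Fin.cons s w)) x
    have hGH (t : I) : p s * G t - H t ∈ lowerC A p (n + 1) := by
      have e : p s * G t = act C (fun w => p s * repWord Λ ι p n t w) x :=
        map_act (LinearMap.mulLeft ℂ (p s)) C _ x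
      rw [e, ← Pi.sub_apply, ← act_sub]
      refine act_mem _ _ (fun w => ?_) x
      obtain ⟨k, z, rfl⟩ := exists_eq_cons w
      obtain ⟨d, hd⟩ := hf.p_mul_rep hΛ s k t
      have hd' : ι d * wordProd p z ∈ lower A p (n + 1) :=
        hB.mul_mem_submodule _ _ (wordProd_mem_lower p (Nat.lt_succ_self n) _)
      have hd₂ : ι d = _ := hd
      rw [hd₂] at hd'
      convert hd' using 1
      simp only [repWord_cons, act_headTensor]
      simp only [act, wordProd_cons, Fintype.sum_prod_type, sub_mul,
        Finset.sum_mul, smul_mul_assoc, mul_assoc]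
      rfl
    have h4 : ∑ t, (p s * G t - H t) ⊗ₜ[ℂ] p t ∈ tens (lowerC A p (n + 1)) ⊤ :=
      sum_mem fun t _ => tmul_mem_tens (hGH t) Submodule.mem_top
    have hact (t : I) : act (braidedNumber R (n + 1 + 1)) (repWord Λ ι p (n + 1) t)
        (Fin.cons s x) = ι (Λ s t) * wordProd p x + H t := by
      rw [braidedNumber_succ, act_add, act_one, Pi.add_apply, act_mul, act_idTensor, repWord_cons]
    simp only [hact]
    rw [wordProd_cons, Bialgebra.comul_mul, hK₂, hB.comul_p]
    convert add_mem (add_mem h1 h2) (add_mem h3 h4) using 1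
    simp only [add_mul, mul_add, Finset.sum_mul, Finset.mul_sum, mul_one,
      Algebra.TensorProduct.tmul_mul_tmul, TensorProduct.add_tmul, TensorProduct.sub_tmul,
      Finset.sum_add_distrib, Finset.sum_sub_distrib, one_mul]
    abel

omit [DecidableEq I] in
/-- The matrix `Θ_ts = S⁻¹(Λ_ts)`, which inverts `Λ` with respect to the opposite multiplication. -/
theorem exists_antipode_inv [DecidableEq I]
    (hS : Function.Bijective (HopfAlgebra.antipode ℂ (A := A))) (hΛ : IsRepresentation Λ) :
    ∃ Θ : Matrix I I A, ∀ a s, ∑ t, Θ t s * Λ a t = if a = s then 1 else 0 := by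
  let e := LinearEquiv.ofBijective (HopfAlgebra.antipode ℂ (A := A)) hS
  refine ⟨Λ.map e.symm, fun a s => hS.1 ?_⟩
  have h1 := HopfAlgebra.mul_antipode_rTensor_comul_apply (R := ℂ) (Λ a s)
  have he (b : A) : HopfAlgebra.antipode ℂ (e.symm b) = b := e.apply_symm_apply b
  rw [hΛ.1, hΛ.2] at h1
  simp only [map_sum, LinearMap.rTensor_tmul, LinearMap.mul'_apply] at h1
  simp only [map_sum, HopfAlgebra.antipode_mul_antidistrib, Matrix.map_apply, he, h1,
    Matrix.one_apply]
  split_ifs <;> simp [HopfAlgebra.antipode_one]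

/-- A combination of words of length `n` that is of lower degree is killed by the braided
factorial. -/
theorem IsInhomogeneousExtension.vecMul_braidedFactorial (hB : IsInhomogeneousExtension Λ ι p)
    (hS : Function.Bijective (HopfAlgebra.antipode ℂ (A := A))) (hΛ : IsIrreducibleRep Λ)
    (hf : IsCommutationFamily ι p f) {n : ℕ} {c : (Fin n → I) → ℂ}
    (hc : ∑ x, c x • wordProd p x ∈ lower A p n) :
    Matrix.vecMul c (braidedFactorial (RMatrix f Λ) n) = 0 := by
  set R := RMatrix f Λ
  induction n with
  | zero =>
    have h1 : (1 : B) ≠ 0 := by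
      intro h
      obtain ⟨i, hi⟩ := hB.notMem
      exact hi ⟨0, by rw [map_zero, ← mul_one (p i), h, mul_zero]⟩
    rw [lower_zero, Submodule.mem_bot] at hc
    simp only [wordProd_zero, Fintype.sum_unique, smul_eq_zero, h1, or_false] at hc
    rw [braidedFactorial_zero, Matrix.vecMul_one]
    funext x
    rw [Subsingleton.elim x default, hc, Pi.zero_apply]
  | succ n ih =>
    obtain ⟨h, hA, hp⟩ := hB.exists_dual hΛ
    obtain ⟨Θ, hΘ⟩ := exists_antipode_inv hS hΛ.1
    let C := braidedNumber R (n + 1)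
    let d := Matrix.vecMul c C
    have h1 := hB.comul_mem_lower_succ hc
    have h2 : ∑ x, c x • (Coalgebra.comul (R := ℂ) (wordProd p x) - wordProd p x ⊗ₜ[ℂ] 1 -
        ∑ t, act C (repWord Λ ι p n t) x ⊗ₜ[ℂ] p t) ∈ tens (lowerC A p n) ⊤ :=
      sum_mem fun x _ => Submodule.smul_mem _ _ (hB.comul_wordProd_succ hΛ.1 hf x)
    have h3 : ∑ x, c x • (wordProd p x ⊗ₜ[ℂ] (1 : B)) ∈ tens ⊤ (imageA ι) :=
      sum_mem fun x _ => Submodule.smul_mem _ _ (tmul_mem_tens Submodule.mem_top one_mem_imageA)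
    have h4 : ∑ x, c x • ∑ t, act C (repWord Λ ι p n t) x ⊗ₜ[ℂ] p t ∈
        tens ⊤ (imageA ι) ⊔ tens (lowerC A p n) ⊤ := by
      convert sub_mem (sub_mem h1 (Submodule.mem_sup_left h3)) (Submodule.mem_sup_right h2) using 1
      simp only [map_sum, map_smul, smul_sub, Finset.sum_sub_distrib]
      abel
    have h5 (t : I) : ∑ y, d y • repWord Λ ι p n t y ∈ lowerC A p n := by
      rw [← sum_smul_act]
      have h6 (z : B ⊗[ℂ] B) (hz : z ∈ tens ⊤ (imageA ι) ⊔ tens (lowerC A p n) ⊤) :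
          applyRight (h t) z ∈ lowerC A p n := by
        obtain ⟨u, hu, v, hv, rfl⟩ := Submodule.mem_sup.1 hz
        have hu' : applyRight (h t) u = 0 := (Submodule.mem_bot ℂ).1
          (tens_le_comap (g := applyRight (h t)) (X := ⊥) (fun b _ c hc => by
            rw [applyRight_tmul, hA t c hc, zero_smul]; exact zero_mem _) hu)
        rw [map_add, hu', zero_add]
        exact applyRight_mem _ hv
      have h7 := h6 _ h4
      simpa only [map_sum, map_smul, applyRight_tmul, hp, ite_smul, one_smul, zero_smul,
        Finset.sum_ite_eq', Finset.mem_univ, if_true] using h7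
    -- The entries of `Λ` are removed by `Θ`, multiplied from the left, which
    -- preserves `lower A p n`.
    have h8 (s : I) : ∑ z, d (Fin.cons s z) • wordProd p z ∈ lower A p n := by
      have h9 : ∑ t, ι (Θ t s) * ∑ y, d y • repWord Λ ι p n t y ∈ lower A p n :=
        sum_mem fun t _ => hB.mul_mem_submodule _ _ (h5 t)
      convert h9 using 1
      simp only [sum_cons, repWord_cons, Finset.mul_sum, mul_smul_comm]
      have h10 (a : I) : ∑ t, ι (Θ t s) * ι (Λ a t) = if a = s then 1 else 0 := by
        have := congrArg ι (hΘ a s)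
        simp only [map_sum, map_mul] at this
        rw [this]
        split_ifs <;> simp
      calc _ = ∑ a, ∑ z, d (Fin.cons a z) • ((∑ t, ι (Θ t s) * ι (Λ a t)) * wordProd p z) := by
            simp [h10, ite_mul]
        _ = _ := by
            simp only [Finset.sum_mul, Finset.smul_sum, ← mul_assoc]
            exact (Finset.sum_comm.trans (Finset.sum_congr rfl fun a _ => Finset.sum_comm)).symm
    funext w
    obtain ⟨s, w, rfl⟩ := exists_eq_cons w
    have h11 := congrFun (ih (h8 s)) w
    rw [braidedFactorial_succ, ← Matrix.vecMul_vecMul,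
      show Matrix.vecMul c (braidedNumber R (n + 1)) = d from rfl]
    clear_value d
    simp only [Matrix.vecMul, dotProduct, sum_cons, idTensor, Matrix.of_apply, Fin.cons_zero,
      Fin.tail_cons] at h11 ⊢
    rw [Finset.sum_eq_single s (fun a _ ha => by simp [ha]) (by simp)]
    simpa using h11

/-- A combination of words of length `n` with coefficients in `A` that is of lower degree is killed
by the braided factorial. -/
theorem IsInhomogeneousExtension.sum_mul_braidedFactorial (hB : IsInhomogeneousExtension Λ ι p)
    (hS : Function.Bijective (HopfAlgebra.antipode ℂ (A := A))) (hΛ : IsIrreducibleRep Λ)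
    (hf : IsCommutationFamily ι p f) {n : ℕ} {a : (Fin n → I) → A}
    (ha : ∑ x, ι (a x) * wordProd p x ∈ lower A p n) (y : Fin n → I) :
    ∑ x, braidedFactorial (RMatrix f Λ) n x y • a x = 0 := by
  refine (Module.forall_dual_apply_eq_zero_iff ℂ _).1 fun h => ?_
  have h1 := hB.extract hS (lower A p n) (fun b hb => hB.comul_mem_lower hb)
    (fun x => hB.comul_wordProd x) ha h
  have h2 := congrFun (hB.vecMul_braidedFactorial hS hΛ hf h1) y
  simpa [Matrix.vecMul, dotProduct, mul_comm] using h2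

end Coproduct

/-! ### Symmetrized words generate -/

section Generation

variable {A B I : Type*} [Ring A] [HopfAlgebra ℂ A] [Ring B] [Bialgebra ℂ B] [Module A B]
  [Fintype I] [DecidableEq I] {Λ : Matrix I I A} {ι : A →ₐc[ℂ] B} {p : I → B}
  {R : Matrix (I × I) (I × I) ℂ}

theorem IsInhomogeneousExtension.exists_mem_lower (hB : IsInhomogeneousExtension Λ ι p) (b : B) :
    ∃ N, b ∈ lower A p N := by
  have := hB.isScalarTower
  suffices h : ∀ N, ∀ c ∈ lower A p N, ∃ M, b * c ∈ lower A p M by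
    obtain ⟨M, hM⟩ := h 1 1 (hB.mem_lower_one.2 one_mem_imageA)
    exact ⟨M, by rwa [mul_one] at hM⟩
  have hb : b ∈ Algebra.adjoin ℂ (Set.range ι ∪ Set.range p) := hB.generated ▸ Algebra.mem_top
  induction hb using Algebra.adjoin_induction with
  | mem x hx =>
    intro N c hc
    rcases hx with ⟨a, rfl⟩ | ⟨s, rfl⟩
    · exact ⟨N, hB.mul_mem_submodule _ a hc⟩
    · exact ⟨N + 1, hB.p_mul_mem_lower s hc⟩
  | algebraMap k =>
    intro N c hc
    rw [Algebra.algebraMap_eq_smul_one, smul_mul_assoc, one_mul]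
    exact ⟨N, (lowerC A p N).smul_mem k hc⟩
  | add x y _ _ hx hy =>
    intro N c hc
    obtain ⟨M, hM⟩ := hx N c hc
    obtain ⟨M', hM'⟩ := hy N c hc
    rw [add_mul]
    exact ⟨max M M', add_mem (lower_mono p (le_max_left _ _) hM)
      (lower_mono p (le_max_right _ _) hM')⟩
  | mul x y _ _ hx hy =>
    intro N c hc
    obtain ⟨M, hM⟩ := hy N c hc
    rw [mul_assoc]
    exact hx M _ hM

variable [IsScalarTower ℂ A B]

/-- Applying `R_k` to a word changes it by shorter words only. As `(1 - R)(R + 1) = 0`, the rows of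
`1 - R` are coefficients of quadratic relations. -/
theorem IsInhomogeneousExtension.act_natRk (hB : IsInhomogeneousExtension Λ ι p) (h2 : R ^ 2 = 1)
    (hq : ∀ x : I × I → ℂ, Matrix.vecMul x (R + 1) = 0 → IsQuadraticRelation ι p x) (n k : ℕ)
    (x : Fin n → I) : act (natRk R n k) (wordProd p) x - wordProd p x ∈ lowerC A p n := by
  induction n generalizing k with
  | zero => simp [natRk, act_one]
  | succ n ih =>
    rcases k with _ | k
    · rcases n with _ | n
      · simp [natRk, act_one]
      · obtain ⟨a, x, rfl⟩ := exists_eq_cons x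
        obtain ⟨b, z, rfl⟩ := exists_eq_cons x
        obtain ⟨d, c, hdc⟩ := hq (fun q => (1 - R) (a, b) q) (by
          have h : (1 - R) * (R + 1) = 0 := by
            rw [sub_mul, mul_add, mul_add, ← pow_two R, h2, one_mul, one_mul, mul_one]
            abel
          funext y
          exact congrFun (congrFun h (a, b)) y)
        have h1 : (act (headTensor n R) (wordProd p) (Fin.cons a (Fin.cons b z)) -
            wordProd p (Fin.cons a (Fin.cons b z))) =
              (∑ i, ι (d i) * p i + ι c) * wordProd p z := by
          have h3 : ∑ i, ∑ j, (1 - R) (a, b) (i, j) • (p i * p j) =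
              p a * p b - ∑ i, ∑ j, R (a, b) (i, j) • (p i * p j) := by
            rw [← Fintype.sum_prod_type' fun i j => (1 - R) (a, b) (i, j) • (p i * p j),
              ← Fintype.sum_prod_type' fun i j => R (a, b) (i, j) • (p i * p j)]
            simp [sub_smul, Matrix.one_apply, ite_smul]
          rw [h3, add_assoc] at hdc
          rw [← sub_eq_zero, ← zero_mul (wordProd p z), ← neg_eq_zero.2 hdc, act_headTensor]
          simp only [act, wordProd_cons, Fintype.sum_prod_type, neg_mul, add_mul, sub_mul,
            Finset.sum_mul, smul_mul_assoc, mul_assoc]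
          abel
        rw [natRk_zero, h1, add_mul, Finset.sum_mul]
        refine add_mem (sum_mem fun i _ => ?_)
          (hB.mul_mem_submodule _ _ (wordProd_mem_lower p (by omega) z))
        rw [mul_assoc]
        exact hB.mul_mem_submodule _ _
          (hB.p_mul_mem_lower i (wordProd_mem_lower p (Nat.lt_succ_self n) z))
    · obtain ⟨a, z, rfl⟩ := exists_eq_cons x
      rw [natRk_succ, act_idTensor]
      simp only [wordProd_cons]
      have h1 : act (natRk R n k) (fun w => p a * wordProd p w) z =
          p a * act (natRk R n k) (wordProd p) z :=
        (map_act (LinearMap.mulLeft ℂ (p a)) _ _ z).symm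
      rw [h1, ← mul_sub]
      exact hB.p_mul_mem_lower a (ih k z)

/-- Symmetrizing a word changes it by shorter words only. -/
theorem IsInhomogeneousExtension.act_symmetrizer (hB : IsInhomogeneousExtension Λ ι p)
    (h2 : R ^ 2 = 1)
    (hq : ∀ x : I × I → ℂ, Matrix.vecMul x (R + 1) = 0 → IsQuadraticRelation ι p x) (n : ℕ)
    (x : Fin n → I) : act (symmetrizer R n) (wordProd p) x - wordProd p x ∈ lowerC A p n := by
  have hlist (l : List (Fin (n - 1))) (x : Fin n → I) :
      act (l.map (Rk R n)).prod (wordProd p) x - wordProd p x ∈ lowerC A p n := by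
    induction l generalizing x with
    | nil => simp [act_one]
    | cons k l ih =>
      rw [List.map_cons, List.prod_cons, act_mul, ← sub_add_sub_cancel _
        (act (Rk R n k) (wordProd p) x), ← Pi.sub_apply (act _ _), ← act_sub]
      refine add_mem (act_mem _ _ ih x) ?_
      rw [← natRk_val]
      exact hB.act_natRk h2 hq n k x
  have h0 : (n ! : ℂ) ≠ 0 := by exact_mod_cast n.factorial_ne_zero
  have h1 : act (symmetrizer R n) (wordProd p) x - wordProd p x =
      (n ! : ℂ)⁻¹ • ∑ π : Equiv.Perm (Fin n), (act (Rperm R π) (wordProd p) x - wordProd p x) := by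
    have h3 : act (∑ π : Equiv.Perm (Fin n), Rperm R π) (wordProd p) x =
        ∑ π : Equiv.Perm (Fin n), act (Rperm R π) (wordProd p) x := by
      simp only [act, Matrix.sum_apply, Finset.sum_smul]
      exact Finset.sum_comm
    rw [symmetrizer, act_smul, Pi.smul_apply, h3, Finset.sum_sub_distrib, smul_sub,
      Finset.sum_const, Finset.card_univ, Fintype.card_perm, Fintype.card_fin,
      ← Nat.cast_smul_eq_nsmul ℂ, inv_smul_smul₀ h0]
  rw [h1]
  exact Submodule.smul_mem _ _ (sum_mem fun π _ => hlist _ x)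

omit [Module A B] [IsScalarTower ℂ A B] [DecidableEq I] in
theorem evalTensor_eq [DecidableEq I] {n : ℕ} (c : ((Fin n → I) → ℂ) →ₗ[ℂ] ℂ) :
    evalTensor p c = ∑ x, c (Pi.single x 1) • wordProd p x := by
  unfold evalTensor wordProd
  refine Finset.sum_congr rfl fun x _ => ?_
  congr!

theorem apply_eq_sum_single {J : Type*} [Fintype J] [DecidableEq J] (c : (J → ℂ) →ₗ[ℂ] ℂ)
    (v : J → ℂ) : c v = ∑ y, v y * c (Pi.single y 1) := by
  conv_lhs => rw [← Finset.univ_sum_single v]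
  rw [map_sum]
  refine Finset.sum_congr rfl fun y _ => ?_
  rw [← smul_eq_mul, ← map_smul, ← Pi.single_smul, smul_eq_mul, mul_one]

theorem vecMul_apply_single {J : Type*} [Fintype J] [DecidableEq J] (c : (J → ℂ) →ₗ[ℂ] ℂ)
    (X : Matrix J J ℂ) (x : J) : Matrix.vecMul (fun y => c (Pi.single y 1)) X x =
      c (X.mulVec (Pi.single x 1)) := by
  rw [apply_eq_sum_single]
  simp [Matrix.vecMul, dotProduct, mul_comm]

/-- Covectors that vanish on the image of the symmetrizer give elements of lower degree. -/
theorem IsInhomogeneousExtension.evalTensor_mem_lower (hB : IsInhomogeneousExtension Λ ι p)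
    (h2 : R ^ 2 = 1)
    (hq : ∀ x : I × I → ℂ, Matrix.vecMul x (R + 1) = 0 → IsQuadraticRelation ι p x) {n : ℕ}
    {c : ((Fin n → I) → ℂ) →ₗ[ℂ] ℂ} (hc : ∀ v, c ((symmetrizer R n).mulVec v) = 0) :
    evalTensor p c ∈ lowerC A p n := by
  have h1 : ∑ x, c (Pi.single x 1) • (act (symmetrizer R n) (wordProd p) x - wordProd p x) ∈
      lowerC A p n :=
    sum_mem fun x _ => Submodule.smul_mem _ _ (hB.act_symmetrizer h2 hq n x)
  simp only [smul_sub, Finset.sum_sub_distrib] at h1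
  rw [sum_smul_act (fun x => c (Pi.single x 1)), ← evalTensor_eq] at h1
  simp only [vecMul_apply_single, hc, zero_smul, Finset.sum_const_zero, zero_sub] at h1
  exact neg_mem_iff.1 h1

omit [Module A B] [IsScalarTower ℂ A B] in
theorem evalTensor_proj {n : ℕ} (x : Fin n → I) :
    evalTensor p (LinearMap.proj x) = wordProd p x := by
  simp [evalTensor_eq, Pi.single_apply, ite_smul]

variable {γ : ∀ n : ℕ, Module.Basis (Fin (symmetrizer R n).rank ⊕ Fin (1 - symmetrizer R n).rank)
  ℂ ((Fin n → I) → ℂ)}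

/-- A word is expanded in the dual basis; the part that belongs to the image of `1 - S_n` is of
lower degree. -/
theorem IsInhomogeneousExtension.wordProd_mem_span (hB : IsInhomogeneousExtension Λ ι p)
    (h2 : R ^ 2 = 1)
    (hq : ∀ x : I × I → ℂ, Matrix.vecMul x (R + 1) = 0 → IsQuadraticRelation ι p x)
    (hγ : ∀ n, IsAdapted R (γ n)) {n : ℕ} (x : Fin n → I) :
    wordProd p x ∈ lower A p n ⊔
      Submodule.span A (Set.range fun i => evalTensor p ((γ n).coord (Sum.inl i))) := by
  have h1 : wordProd p x = ∑ i, γ n i x • evalTensor p ((γ n).coord i) := by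
    conv_lhs => rw [← evalTensor_proj, ← (γ n).sum_dual_apply_smul_coord (LinearMap.proj x)]
    simp only [evalTensor_eq, LinearMap.sum_apply, LinearMap.smul_apply, LinearMap.proj_apply,
      smul_eq_mul, Finset.sum_smul, Finset.smul_sum, mul_smul]
    exact Finset.sum_comm
  have hsub (L : Submodule A B) {b : B} (k : ℂ) (hb : b ∈ L) : k • b ∈ L :=
    (L.restrictScalars ℂ).smul_mem k hb
  rw [h1, Fintype.sum_sum_type]
  refine add_mem (sum_mem fun i _ => hsub _ _ (Submodule.mem_sup_right
    (Submodule.subset_span ⟨i, rfl⟩))) (sum_mem fun j _ => hsub _ _ (Submodule.mem_sup_left ?_))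
  refine hB.evalTensor_mem_lower h2 hq fun v => ?_
  have h3 : (symmetrizer R n).mulVec v ∈ Submodule.span ℂ (Set.range fun i => γ n (Sum.inl i)) := by
    rw [(hγ n).1]
    exact ⟨v, rfl⟩
  have h4 : Submodule.span ℂ (Set.range fun i => γ n (Sum.inl i)) ≤
      LinearMap.ker ((γ n).coord (Sum.inr j)) := by
    rw [Submodule.span_le]
    rintro _ ⟨i, rfl⟩
    simp
  exact h4 h3

theorem IsInhomogeneousExtension.span_eq_lower (hB : IsInhomogeneousExtension Λ ι p)
    (h2 : R ^ 2 = 1)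
    (hq : ∀ x : I × I → ℂ, Matrix.vecMul x (R + 1) = 0 → IsQuadraticRelation ι p x)
    (hγ : ∀ n, IsAdapted R (γ n)) (N : ℕ) :
    Submodule.span A (Set.range fun q : Σ n : Fin N, Fin (symmetrizer R n).rank =>
      evalTensor p ((γ q.1).coord (Sum.inl q.2))) = lower A p N := by
  refine le_antisymm ?_ ?_
  · rw [Submodule.span_le]
    rintro _ ⟨⟨n, i⟩, rfl⟩
    change evalTensor p _ ∈ _
    rw [evalTensor_eq]
    exact sum_mem fun x _ => (lowerC A p N).smul_mem _ (wordProd_mem_lower p n.2 x)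
  · induction N with
    | zero => simp [lower_zero]
    | succ N ih =>
      have h3 : lower A p N ≤ Submodule.span A (Set.range fun q : Σ n : Fin (N + 1),
          Fin (symmetrizer R n).rank => evalTensor p ((γ q.1).coord (Sum.inl q.2))) := by
        refine ih.trans (Submodule.span_mono ?_)
        rintro _ ⟨⟨n, i⟩, rfl⟩
        exact ⟨⟨n.castSucc, i⟩, rfl⟩
      rw [lower, Submodule.span_le]
      rintro _ ⟨m, hm, x, rfl⟩
      rcases Nat.lt_succ_iff_lt_or_eq.1 hm with hm | rfl
      · exact h3 (wordProd_mem_lower p hm x)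
      · refine sup_le h3 (Submodule.span_mono ?_) (hB.wordProd_mem_span h2 hq hγ x)
        rintro _ ⟨i, rfl⟩
        exact ⟨⟨Fin.last m, i⟩, rfl⟩

end Generation

/-! ### Symmetrized words are independent -/

/-- A family graded by the natural numbers is linearly independent if its members of degree `n`
lie in `L (n + 1)` and are linearly independent modulo `L n`. -/
theorem linearIndependent_of_graded {A B : Type*} [Ring A] [AddCommGroup B] [Module A B]
    {L : ℕ → Submodule A B} (hL : Monotone L) {κ : ℕ → Type*} [∀ n, Fintype (κ n)]
    {v : ∀ n, κ n → B} (hv : ∀ n i, v n i ∈ L (n + 1))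
    (h : ∀ n (a : κ n → A), ∑ i, a i • v n i ∈ L n → a = 0) :
    LinearIndependent A fun q : Σ n, κ n => v q.1 q.2 := by
  rw [linearIndependent_iff]
  intro l hl
  have key (N : ℕ) (hN : ∀ q, N ≤ q.1 → l q = 0) : l = 0 := by
    induction N with
    | zero => exact Finsupp.ext fun q => hN q (Nat.zero_le _)
    | succ N ih =>
      refine ih fun q hq => ?_
      have h1 : l.support ⊆ (Finset.range (N + 1)).sigma fun _ => Finset.univ := by
        intro q hq
        by_contra hq'
        refine Finsupp.mem_support_iff.1 hq (hN q ?_)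
        simpa using hq'
      rw [Finsupp.linearCombination_apply, Finsupp.sum_of_support_subset l h1 _ (by simp),
        Finset.sum_sigma, Finset.sum_range_succ] at hl
      have h2 : ∑ i, l ⟨N, i⟩ • v N i ∈ L N := by
        rw [eq_neg_of_add_eq_zero_right hl]
        exact neg_mem (sum_mem fun n hn => sum_mem fun i _ => (L N).smul_mem _
          (hL (Finset.mem_range.1 hn) (hv n i)))
      obtain ⟨n, i⟩ := q
      rcases (show N = n ∨ N + 1 ≤ n from Nat.eq_or_lt_of_le hq) with rfl | hn
      · exact congrFun (h N _ h2) i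
      · exact hN _ hn
  refine key ((l.support.sup fun q => q.1) + 1) fun q hq => ?_
  by_contra hlq
  have := Finset.le_sup (f := fun q : Σ n, κ n => q.1) (Finsupp.mem_support_iff.2 hlq)
  change q.1 ≤ _ at this
  omega

/-- The counit maps an invertible matrix over `A` to an invertible complex one, which is square. -/
theorem invariantBasisNumber_of_bialgebra (A : Type*) [Ring A] [Bialgebra ℂ A] :
    InvariantBasisNumber A := by
  refine invariantBasisNumber_iff_matrix.2 fun n m X Y h1 h2 => ?_
  let ε := (Bialgebra.counitAlgHom ℂ A : A →+* ℂ)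
  refine invariantBasisNumber_iff_matrix.1 (inferInstanceAs (InvariantBasisNumber ℂ)) n m
    (X.map ε) (Y.map ε) ?_ ?_
  · rw [← Matrix.map_mul, h1, Matrix.map_one _ (map_zero _) (map_one _)]
  · rw [← Matrix.map_mul, h2, Matrix.map_one _ (map_zero _) (map_one _)]

theorem exists_isAdapted {I : Type*} [Fintype I] [DecidableEq I] {R : Matrix (I × I) (I × I) ℂ}
    {n : ℕ} (h : IsCompl (LinearMap.range (symmetrizer R n).mulVecLin)
      (LinearMap.range (1 - symmetrizer R n).mulVecLin)) :
    ∃ γ : Module.Basis (Fin (symmetrizer R n).rank ⊕ Fin (1 - symmetrizer R n).rank) ℂ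
      ((Fin n → I) → ℂ), IsAdapted R γ := by
  let b₁ := Module.finBasisOfFinrankEq ℂ (LinearMap.range (symmetrizer R n).mulVecLin)
    (n := (symmetrizer R n).rank) rfl
  let b₂ := Module.finBasisOfFinrankEq ℂ (LinearMap.range (1 - symmetrizer R n).mulVecLin)
    (n := (1 - symmetrizer R n).rank) rfl
  have hspan {d : ℕ} {W : Submodule ℂ ((Fin n → I) → ℂ)} (b : Module.Basis (Fin d) ℂ W) :
      Submodule.span ℂ (Set.range fun i => (b i : (Fin n → I) → ℂ)) = W := by
    have := congrArg (Submodule.map W.subtype) b.span_eq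
    rwa [Submodule.map_span, ← Set.range_comp, Submodule.map_top, Submodule.range_subtype] at this
  refine ⟨(b₁.prod b₂).map (Submodule.prodEquivOfIsCompl _ _ h), ?_, ?_⟩
  · simpa using hspan b₁
  · simpa using hspan b₂

section Independence

variable {A B I : Type*} [Ring A] [HopfAlgebra ℂ A] [Ring B] [Bialgebra ℂ B] [Module A B]
  [Fintype I] [DecidableEq I] {Λ : Matrix I I A} {ι : A →ₐc[ℂ] B} {p : I → B}
  {f : I → I → A →ₗ[ℂ] ℂ} [IsScalarTower ℂ A B]

/-- The covectors dual to the basis of the image of the symmetrizer give elements that are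
independent over `A`, modulo lower degree, since the braided factorial is a nonzero multiple of the
symmetrizer. -/
theorem IsInhomogeneousExtension.coeff_evalTensor_eq_zero (hB : IsInhomogeneousExtension Λ ι p)
    (hS : Function.Bijective (HopfAlgebra.antipode ℂ (A := A))) (hΛ : IsIrreducibleRep Λ)
    (hf : IsCommutationFamily ι p f) (h2 : RMatrix f Λ ^ 2 = 1) {n : ℕ}
    {γ : Module.Basis (Fin (symmetrizer (RMatrix f Λ) n).rank ⊕
      Fin (1 - symmetrizer (RMatrix f Λ) n).rank) ℂ ((Fin n → I) → ℂ)}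
    (hγ : IsAdapted (RMatrix f Λ) γ) {a : Fin (symmetrizer (RMatrix f Λ) n).rank → A}
    (ha : ∑ i, a i • evalTensor p (γ.coord (Sum.inl i)) ∈ lower A p n) : a = 0 := by
  have hR := hB.isBraiding hS hΛ hf
  have h0 : (n ! : ℂ) ≠ 0 := by exact_mod_cast n.factorial_ne_zero
  have hSS := symmetrizer_mul_self hR h2 n
  have hD : braidedFactorial (RMatrix f Λ) n = (n ! : ℂ) • symmetrizer (RMatrix f Λ) n := by
    rw [symmetrizer_eq hR h2, smul_inv_smul₀ h0]
  have h1 : ∑ x, ι (∑ i, γ.coord (Sum.inl i) (Pi.single x 1) • a i) * wordProd p x ∈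
      lower A p n := by
    convert ha using 1
    simp only [hB.smul_eq, evalTensor_eq, Finset.mul_sum, map_sum, map_smul, Finset.sum_mul,
      smul_mul_assoc, mul_smul_comm]
    exact Finset.sum_comm
  have h3 := hB.sum_mul_braidedFactorial hS hΛ hf h1
  have h4 (v : (Fin n → I) → ℂ) :
      ∑ i, γ.coord (Sum.inl i) ((symmetrizer (RMatrix f Λ) n).mulVec v) • a i = 0 := by
    have h5 (y : Fin n → I) :
        ∑ i, γ.coord (Sum.inl i) ((symmetrizer (RMatrix f Λ) n).mulVec (Pi.single y 1)) • a i =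
          0 := by
      have h6 := h3 y
      change ∑ x, braidedFactorial (RMatrix f Λ) n x y • _ = 0 at h6
      simp only [hD, Matrix.smul_apply, smul_eq_mul, mul_smul, ← Finset.smul_sum] at h6
      rw [smul_eq_zero_iff_right h0] at h6
      rw [← h6]
      simp only [Finset.smul_sum, smul_smul, ← vecMul_apply_single, Matrix.vecMul, dotProduct,
        Finset.sum_smul]
      rw [Finset.sum_comm]
      simp only [mul_comm]
    let g : ((Fin n → I) → ℂ) →ₗ[ℂ] A := ∑ i,
      (γ.coord (Sum.inl i) ∘ₗ (symmetrizer (RMatrix f Λ) n).mulVecLin).smulRight (a i)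
    have hg (v) : g v =
        ∑ i, γ.coord (Sum.inl i) ((symmetrizer (RMatrix f Λ) n).mulVec v) • a i := by
      simp [g]
    have : g = 0 := LinearMap.pi_ext' fun y => LinearMap.ext_ring (by
      simpa [hg] using h5 y)
    rw [← hg, this, LinearMap.zero_apply]
  funext i
  obtain ⟨w, hw⟩ : γ (Sum.inl i) ∈ LinearMap.range (symmetrizer (RMatrix f Λ) n).mulVecLin := by
    rw [← hγ.1]
    exact Submodule.subset_span ⟨i, rfl⟩
  have h7 : (symmetrizer (RMatrix f Λ) n).mulVec (γ (Sum.inl i)) = γ (Sum.inl i) := by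
    rw [← hw, Matrix.mulVecLin_apply, Matrix.mulVec_mulVec, hSS]
  have h8 := h4 (γ (Sum.inl i))
  rw [h7] at h8
  simpa [Finsupp.single_apply, ite_smul] using h8

end Independence

end InhomogeneousQG

end

open InhomogeneousQG in
theorem corollary3p6 {A B I : Type*} [Ring A] [HopfAlgebra ℂ A] [Ring B] [Bialgebra ℂ B]
    [Module A B] [Fintype I] [DecidableEq I]
    (hS : Function.Bijective (HopfAlgebra.antipode ℂ (A := A)))
    (Λ : Matrix I I A) (ι : A →ₐc[ℂ] B) (p : I → B)
    (hB : IsInhomogeneousExtension Λ ι p)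
    (ha : ∀ (n : ℕ) (v : Matrix (Fin n) (Fin n) A),
      IsRepresentation v → IsCompletelyReducible v)
    (hΛ : IsIrreducibleRep Λ)
    (hc : ∀ (m n : ℕ) (v : Matrix (Fin m) (Fin m) A) (w : Matrix (Fin n) (Fin n) A),
      IsIrreducibleRep v → IsIrreducibleRep w →
        ∀ M : Matrix (I × (Fin m × Fin n)) (Fin m × Fin n) ℂ,
          IsIntertwiner (v ⊗ₖ w) (Λ ⊗ₖ (v ⊗ₖ w)) M → M = 0) :
    (∃! f : I → I → A →ₗ[ℂ] ℂ, IsCommutationFamily ι p f) ∧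
    ∀ f : I → I → A →ₗ[ℂ] ℂ, IsCommutationFamily ι p f →
      RMatrix f Λ ^ 2 = 1 →
      (∀ x : I × I → ℂ,
        Matrix.vecMul x (RMatrix f Λ + 1) = 0 ↔ IsQuadraticRelation ι p x) →
      (∀ n : ℕ, IsCompl (LinearMap.range (symmetrizer (RMatrix f Λ) n).mulVecLin)
        (LinearMap.range (1 - symmetrizer (RMatrix f Λ) n).mulVecLin)) ∧
      (∀ γ : ∀ n : ℕ, Module.Basis
            (Fin (symmetrizer (RMatrix f Λ) n).rank ⊕ Fin (1 - symmetrizer (RMatrix f Λ) n).rank)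
            ℂ ((Fin n → I) → ℂ),
          (∀ n, IsAdapted (RMatrix f Λ) (γ n)) →
          (LinearIndependent A
              (fun q : Σ n : ℕ, Fin (symmetrizer (RMatrix f Λ) n).rank =>
                evalTensor p ((γ q.1).coord (Sum.inl q.2))) ∧
            Submodule.span A (Set.range
              (fun q : Σ n : ℕ, Fin (symmetrizer (RMatrix f Λ) n).rank =>
                evalTensor p ((γ q.1).coord (Sum.inl q.2)))) = ⊤) ∧
          ∀ N : ℕ,
            LinearIndependent A
              (fun q : Σ n : Fin (N + 1), Fin (symmetrizer (RMatrix f Λ) n).rank =>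
                evalTensor p ((γ q.1).coord (Sum.inl q.2))) ∧
            Submodule.span A (Set.range
              (fun q : Σ n : Fin (N + 1), Fin (symmetrizer (RMatrix f Λ) n).rank =>
                evalTensor p ((γ q.1).coord (Sum.inl q.2)))) = filtration A p N) ∧
      ∀ N : ℕ, HasDim A (filtration A p N)
        (∑ n ∈ Finset.range (N + 1), (symmetrizer (RMatrix f Λ) n).rank) := by
  have := hB.isScalarTower
  refine ⟨hB.existsUnique_commutationFamily hS hΛ, fun f hf h2 hq => ?_⟩
  have hcompl := isCompl_symmetrizer (hB.isBraiding hS hΛ hf) h2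
  have hbasis : ∀ γ : ∀ n : ℕ, Module.Basis
            (Fin (symmetrizer (RMatrix f Λ) n).rank ⊕ Fin (1 - symmetrizer (RMatrix f Λ) n).rank)
            ℂ ((Fin n → I) → ℂ),
          (∀ n, IsAdapted (RMatrix f Λ) (γ n)) →
          (LinearIndependent A
              (fun q : Σ n : ℕ, Fin (symmetrizer (RMatrix f Λ) n).rank =>
                evalTensor p ((γ q.1).coord (Sum.inl q.2))) ∧
            Submodule.span A (Set.range
              (fun q : Σ n : ℕ, Fin (symmetrizer (RMatrix f Λ) n).rank =>
                evalTensor p ((γ q.1).coord (Sum.inl q.2)))) = ⊤) ∧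
          ∀ N : ℕ,
            LinearIndependent A
              (fun q : Σ n : Fin (N + 1), Fin (symmetrizer (RMatrix f Λ) n).rank =>
                evalTensor p ((γ q.1).coord (Sum.inl q.2))) ∧
            Submodule.span A (Set.range
              (fun q : Σ n : Fin (N + 1), Fin (symmetrizer (RMatrix f Λ) n).rank =>
                evalTensor p ((γ q.1).coord (Sum.inl q.2)))) = filtration A p N := by
    intro γ hγ
    have hli : LinearIndependent A
        (fun q : Σ n : ℕ, Fin (symmetrizer (RMatrix f Λ) n).rank =>
          evalTensor p ((γ q.1).coord (Sum.inl q.2))) := by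
      refine linearIndependent_of_graded (L := fun n => lower A p n)
        (v := fun n i => evalTensor p ((γ n).coord (Sum.inl i)))
        (fun m n h => lower_mono p h) (fun n i => ?_)
        (fun n a => hB.coeff_evalTensor_eq_zero hS hΛ hf h2 (hγ n))
      rw [evalTensor_eq]
      exact sum_mem fun x _ => (lowerC A p (n + 1)).smul_mem _
        (wordProd_mem_lower p (Nat.lt_succ_self n) x)
    have hspan := hB.span_eq_lower h2 (fun x => (hq x).1) hγ
    refine ⟨⟨hli, ?_⟩, fun N => ⟨?_, ?_⟩⟩
    · refine Submodule.eq_top_iff'.2 fun b => ?_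
      obtain ⟨N, hN⟩ := hB.exists_mem_lower b
      rw [← hspan] at hN
      refine Submodule.span_mono ?_ hN
      rintro _ ⟨⟨n, i⟩, rfl⟩
      exact ⟨⟨n, i⟩, rfl⟩
    · refine hli.comp (fun q : Σ n : Fin (N + 1), Fin (symmetrizer (RMatrix f Λ) n).rank =>
        (⟨q.1, q.2⟩ : Σ n : ℕ, Fin (symmetrizer (RMatrix f Λ) n).rank)) ?_
      rintro ⟨⟨m, hm⟩, i⟩ ⟨⟨n, hn⟩, j⟩ h
      simp only [Sigma.mk.injEq] at h
      obtain ⟨rfl, h⟩ := h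
      simpa using h
    · rw [filtration_eq_lower, hspan]
  refine ⟨hcompl, hbasis, fun N => ?_⟩
  choose γ hγ using fun n => exists_isAdapted (hcompl n)
  obtain ⟨hli, hspan⟩ := (hbasis γ hγ).2 N
  let b₀ := (Module.Basis.span hli).map (LinearEquiv.ofEq _ _ hspan)
  let b := b₀.reindex (finSigmaFinEquiv.trans
    (finCongr (Finset.sum_range fun n => (symmetrizer (RMatrix f Λ) n).rank).symm))
  have := invariantBasisNumber_of_bialgebra A
  exact ⟨⟨b⟩, fun m ⟨b'⟩ => eq_of_fin_equiv A (b'.equivFun.symm.trans b.equivFun)⟩
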